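/- Let $n,k\ge 1$ and let $H_1,\dots,H_k$ be Hermitian $n\times n$ matrices; put $\langle z,\bar\zeta\rangle_j=\sum_{a,b}(H_j)_{ab}\,z_a\bar\zeta_b$ and $\langle z,\bar\zeta\rangle=(\langle z,\bar\zeta\rangle_1,\dots,\langle z,\bar\zeta\rangle_k)$ for $z,\zeta\in\mathbb C^n$. Assume that the model quadric of codimension $k$ $$\mathcal Q=\{(z,w)\in\mathbb C^n\times\mathbb C^k:\ \operatorname{Im} w=\langle z,\bar z\rangle\}$$ is nondegenerate, i.e. $H_1,\dots,H_k$ are linearly independent over $\mathbb R$, and $\langle e,\bar z\rangle=0$ for all $z$ implies $e=0$. For $\xi\in\mathcal Q$ let $\operatorname{aut}\mathcal Q_\xi$ be the real vector space of germs at $\xi$ of vector fields $X=2\operatorname{Re}\left(f(z,w)\,\frac{\partial}{\partial z}+g(z,w)\,\frac{\partial}{\partial w}\right)$ that are tangent to $\mathcal Q$, where $f$ and $g$ are germs at $\xi$ of holomorphic maps to $\mathbb C^n$ and $\mathbb C^k$; put $\operatorname{aut}\mathcal Q=\operatorname{aut}\mathcal Q_0$. Assign the weights $[z]=1$, $[w]=2$,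 and for $m\in\mathbb Z$ let $g_m\subset\operatorname{aut}\mathcal Q$ be the subspace of the fields of weight $m$: those for which all components of $f$ (resp. of $g$) are weighted homogeneous polynomials of weight $m+1$ (resp. $m+2$). Then: (a) if $m$ is odd and $g_m\neq 0$, then $m\le 2k-1$; (b) if $g_m\ne0$, then $m\le 2k$, and $\operatorname{aut}\mathcal Q=g_{-2}\oplus g_{-1}\oplus g_0\oplus g_1\oplus\dots\oplus g_{2k}$; moreover the sum of all the subspaces $g_m$, $m\in\mathbb Z$, is direct; (c) for every $\xi\in\mathcal Q$ and every $X\in\operatorname{aut}\mathcal Q_\xi$, all components of $f$ and $g$ are (germs of) polynomials in $(z,w)$ of degree at most $k+1$. -/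

import Mathlib

open Filter Topology

noncomputable section

namespace CRQuadric

/-- The space `ℂⁿ × ℂᵏ` with coordinates `p = (z, w)`. -/
abbrev Amb (n k : ℕ) : Type := (Fin n → ℂ) × (Fin k → ℂ)

/-- The vector-valued form `⟨z, ζ̄⟩ = (⟨z, ζ̄⟩₁, …, ⟨z, ζ̄⟩ₖ)` with coefficient matrices `H₁, …, Hₖ`;
it is linear in `z` and antilinear in `ζ`. -/
def form {n k : ℕ} (H : Fin k → Matrix (Fin n) (Fin n) ℂ) (z ζ : Fin n → ℂ) : Fin k → ℂ :=
  fun j => ∑ a, ∑ b, H j a b * z a * (starRingEnd ℂ) (ζ b)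

/-- Nondegeneracy: all the forms are Hermitian, they have no common kernel, and they are
linearly independent over `ℝ`. -/
structure Nondegenerate {n k : ℕ} (H : Fin k → Matrix (Fin n) (Fin n) ℂ) : Prop where
  hermitian : ∀ j, (H j).IsHermitian
  no_kernel : ∀ e : Fin n → ℂ, (∀ z : Fin n → ℂ, form H e z = 0) → e = 0
  linearIndependent : LinearIndependent ℝ H

/-- The defining function `ρ(z, w) = Im w - ⟨z, z̄⟩ ∈ ℝᵏ` (the form `⟨z, z̄⟩` is real when the
matrices are Hermitian). -/
def defFun {n k : ℕ} (H : Fin k → Matrix (Fin n) (Fin n) ℂ) (p : Amb n k) : Fin k → ℝ :=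
  fun j => (p.2 j).im - (form H p.1 p.1 j).re

/-- The model quadric `Q = {Im w = ⟨z, z̄⟩}`. -/
def quadric {n k : ℕ} (H : Fin k → Matrix (Fin n) (Fin n) ℂ) : Set (Amb n k) :=
  {p | defFun H p = 0}

/-- The real vector field `2 Re (f ∂/∂z + g ∂/∂w)`, whose value at `p`, as a real tangent vector
of `ℂⁿ × ℂᵏ`, is `F p = (f p, g p)`, is tangent to the quadric near `ξ`. -/
def IsTangentNear {n k : ℕ} (H : Fin k → Matrix (Fin n) (Fin n) ℂ) (ξ : Amb n k)
    (F : Amb n k → Amb n k) : Prop :=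
  ∀ᶠ p in 𝓝 ξ, p ∈ quadric H → fderiv ℝ (defFun H) p (F p) = 0

/-- The real vector space of the germs at `ξ` of infinitesimal holomorphic automorphisms of the
quadric: germs `(f, g)` of holomorphic fields tangent to the quadric near `ξ`. -/
def autAt {n k : ℕ} (H : Fin k → Matrix (Fin n) (Fin n) ℂ) (ξ : Amb n k) :
    Submodule ℝ (Germ (𝓝 ξ) (Amb n k)) where
  carrier := {X | ∃ F : Amb n k → Amb n k,
    AnalyticAt ℂ F ξ ∧ IsTangentNear H ξ F ∧ X = (F : Germ (𝓝 ξ) (Amb n k))}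
  add_mem' := by
    rintro _ _ ⟨F, hF, tF, rfl⟩ ⟨G, hG, tG, rfl⟩
    refine ⟨F + G, hF.add hG, ?_, rfl⟩
    filter_upwards [tF, tG] with p h1 h2 hp
    simp [h1 hp, h2 hp]
  zero_mem' := by
    refine ⟨0, analyticAt_const, ?_, rfl⟩
    exact Eventually.of_forall fun p _ => by simp
  smul_mem' := by
    rintro c _ ⟨F, hF, tF, rfl⟩
    refine ⟨c • F, ?_, ?_, rfl⟩
    · have h : AnalyticAt ℂ ((c : ℂ) • F) ξ := analyticAt_const.smul hF
      have e : (c : ℂ) • F = c • F := by ext p <;> simp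
      rwa [e] at h
    · filter_upwards [tF] with p h1 hp
      simp [h1 hp]

/-- Polynomials in the coordinates `z₁, …, zₙ, w₁, …, wₖ`. -/
abbrev Poly (n k : ℕ) : Type := MvPolynomial (Fin n ⊕ Fin k) ℂ

/-- The polynomial vector field with coefficients `f = P` and `g = R`. -/
def polyField {n k : ℕ} (P : Fin n → Poly n k) (R : Fin k → Poly n k) (p : Amb n k) : Amb n k :=
  (fun a => MvPolynomial.eval (Sum.elim p.1 p.2) (P a),
   fun j => MvPolynomial.eval (Sum.elim p.1 p.2) (R j))

/-- The weights of the variables: `[z] = 1`, `[w] = 2`. -/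
def wt (n k : ℕ) : Fin n ⊕ Fin k → ℤ := Sum.elim (fun _ => 1) (fun _ => 2)

/-- The component `g_m`: the germs at the origin of fields in `aut Q` of weight `m`. As `∂/∂z` and
`∂/∂w` have the weights `-1` and `-2`, the field `f ∂/∂z + g ∂/∂w` has weight `m` when `f` and `g`
are weighted homogeneous of the weights `m + 1` and `m + 2`. -/
def gr {n k : ℕ} (H : Fin k → Matrix (Fin n) (Fin n) ℂ) (m : ℤ) :
    Submodule ℝ (Germ (𝓝 (0 : Amb n k)) (Amb n k)) where
  carrier := {X | X ∈ autAt H 0 ∧ ∃ (P : Fin n → Poly n k) (R : Fin k → Poly n k),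
    (∀ a, (P a).IsWeightedHomogeneous (wt n k) (m + 1)) ∧
    (∀ j, (R j).IsWeightedHomogeneous (wt n k) (m + 2)) ∧
    X = (polyField P R : Germ (𝓝 (0 : Amb n k)) (Amb n k))}
  add_mem' := by
    rintro _ _ ⟨hX, P, R, hP, hR, rfl⟩ ⟨hY, P', R', hP', hR', rfl⟩
    refine ⟨Submodule.add_mem _ hX hY, P + P', R + R', fun a => (hP a).add (hP' a),
      fun j => (hR j).add (hR' j), ?_⟩
    rw [← Germ.coe_add]
    congr 1
    ext p <;> simp [polyField]
  zero_mem' := by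
    refine ⟨Submodule.zero_mem _, 0, 0,
      fun _ => MvPolynomial.isWeightedHomogeneous_zero _ _ _,
      fun _ => MvPolynomial.isWeightedHomogeneous_zero _ _ _, ?_⟩
    have h : polyField (0 : Fin n → Poly n k) (0 : Fin k → Poly n k) = 0 := by
      ext p <;> simp [polyField]
    rw [h]
    rfl
  smul_mem' := by
    rintro c _ ⟨hX, P, R, hP, hR, rfl⟩
    refine ⟨Submodule.smul_mem _ c hX, (c : ℂ) • P, (c : ℂ) • R,
      fun a => (MvPolynomial.weightedHomogeneousSubmodule ℂ (wt n k) (m + 1)).smul_mem _ (hP a),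
      fun j => (MvPolynomial.weightedHomogeneousSubmodule ℂ (wt n k) (m + 2)).smul_mem _ (hR j), ?_⟩
    rw [← Germ.coe_smul]
    congr 1
    ext p <;> simp [polyField, -Complex.coe_smul, MvPolynomial.smul_eval]

end CRQuadric

end

open Filter Topology

noncomputable section

namespace CRQuadric

/-! Write β for the complex bilinear form `bil`, so that ⟨z, ζ̄⟩ = β(z, ζ̄). Tangency of (f, g)
polarizes to a holomorphic identity (`complexified`): g(z,w) − ḡ(ζ,w') = 2i(β(f(z,w),ζ) +
β(z,f̄(ζ,w'))) whenever w − w' = 2iβ(z,ζ). Putting ζ = 0, or differentiating there, shows that g is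
affine and f quadratic in z. Since real dilations (tz, t²w) preserve the quadric, the weighted
homogeneous parts of a tangent germ are themselves tangent (`isTangent_component`). Everything then
rests on `eq_zero_of_weight`: a tangent field of weight above 2k vanishes.

For that, the identity is read along the lines w = x + τβ(z,ζ), where it becomes a functional
equation in τ that forces coefficients to be affine or quadratic in τ. The values of β span ℂᵏ, and
every vector is a sum of at most (k+1)/2 of them (`exists_list_sum_sub_mem`), since each range
β(z,·) or β(·,ζ) of dimension at least two consists of values of β. Hence a function quadratic along
all values of β has degree at most k+1 on lines through 0. This bound is one too large for f. There
the relevant functions Ψ_c depend linearly on c and are affine along β(c,ζ); differentiating in c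
makes them quadratic along all values of β. Using one affine direction in the range of β(c,·), whose
rank is at least two for generic c, lowers the degree to k
(`eq_zero_of_affineAlong_of_homogeneous`). Homogeneity of larger degree then gives zero.

The degree bound k+1 at the origin follows from the weight bound together with the low degree in z.
Affine automorphisms of the quadric carry it to every other point. -/

/-! ### Functions that are polynomials of bounded degree along lines -/

/-- `φ` is a polynomial function of degree at most `d`. -/
def IsPolyLE (d : ℕ) (φ : ℂ → ℂ) : Prop :=
  ∃ p : Polynomial ℂ, p.natDegree ≤ d ∧ ∀ τ, φ τ = p.eval τ

lemma IsPolyLE.add {d : ℕ} {φ ψ : ℂ → ℂ} (hφ : IsPolyLE d φ) (hψ : IsPolyLE d ψ) :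
    IsPolyLE d (fun τ => φ τ + ψ τ) := by
  obtain ⟨p, hp, hp'⟩ := hφ
  obtain ⟨q, hq, hq'⟩ := hψ
  exact ⟨p + q, Polynomial.natDegree_add_le_of_degree_le hp hq, fun τ => by simp [hp', hq']⟩

lemma IsPolyLE.mul {d e : ℕ} {φ ψ : ℂ → ℂ} (hφ : IsPolyLE d φ) (hψ : IsPolyLE e ψ) :
    IsPolyLE (d + e) (fun τ => φ τ * ψ τ) := by
  obtain ⟨p, hp, hp'⟩ := hφ
  obtain ⟨q, hq, hq'⟩ := hψ
  exact ⟨p * q, Polynomial.natDegree_mul_le_of_le hp hq, fun τ => by simp [hp', hq']⟩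

lemma isPolyLE_affine (a b : ℂ) : IsPolyLE 1 (fun τ => a + b * τ) :=
  ⟨.C a + .C b * .X, by compute_degree, fun τ => by simp⟩

lemma isPolyLE_quadratic (a b c : ℂ) : IsPolyLE 2 (fun τ => a + b * τ + c * τ ^ 2) :=
  ⟨.C a + .C b * .X + .C c * .X ^ 2, by compute_degree, fun τ => by simp⟩

/-- `h` is affine along the lines of direction `v`. -/
def AffineAlong {V : Type*} [AddCommGroup V] [Module ℂ V] (h : V → ℂ) (v : V) : Prop :=
  ∀ x, ∃ a b : ℂ, ∀ τ : ℂ, h (x + τ • v) = a + b * τ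

/-- `h` is at most quadratic along the lines of direction `v`. -/
def QuadraticAlong {V : Type*} [AddCommGroup V] [Module ℂ V] (h : V → ℂ) (v : V) : Prop :=
  ∀ x, ∃ a b c : ℂ, ∀ τ : ℂ, h (x + τ • v) = a + b * τ + c * τ ^ 2

section Lines

variable {V : Type*} [AddCommGroup V] [Module ℂ V]

lemma AffineAlong.eq {h : V → ℂ} {v : V} (H : AffineAlong h v) (x : V) (τ : ℂ) :
    h (x + τ • v) = (1 - τ) * h x + τ * h (x + v) := by
  obtain ⟨a, b, hab⟩ := H x
  have h0 := hab 0
  have h1 := hab 1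
  simp only [zero_smul, add_zero, one_smul] at h0 h1
  rw [hab, h0, h1]
  ring

/-- Lagrange interpolation at τ = 0, 1, 2. The coefficients keep their zero constant terms so that
they match `isPolyLE_quadratic` syntactically. -/
lemma QuadraticAlong.eq {h : V → ℂ} {v : V} (H : QuadraticAlong h v) (x : V) (τ : ℂ) :
    h (x + τ • v) = (1 + (-3 / 2) * τ + (1 / 2) * τ ^ 2) * h x + (0 + 2 * τ + (-1) * τ ^ 2) *
      h (x + v) + (0 + (-1 / 2) * τ + (1 / 2) * τ ^ 2) * h (x + (2 : ℂ) • v) := by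
  obtain ⟨a, b, c, hab⟩ := H x
  have h0 := hab 0
  have h1 := hab 1
  have h2 := hab 2
  simp only [zero_smul, add_zero, one_smul] at h0 h1
  rw [hab, h0, h1, h2]
  ring

/-- Interpolating in the direction of one summand expresses h along the whole sum by h along the
shorter sum from three base points, at a cost of two degrees. -/
lemma isPolyLE_along_list_sum (l : List V) (h : V → ℂ) (H : ∀ v ∈ l, QuadraticAlong h v) (x : V) :
    IsPolyLE (2 * l.length) (fun τ => h (x + τ • l.sum)) := by
  induction l generalizing x with
  | nil => exact ⟨.C (h x), by simp, fun τ => by simp⟩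
  | cons v l ih =>
    have ih' := ih fun u hu => H u (List.mem_cons_of_mem _ hu)
    have key : ∀ τ : ℂ, h (x + τ • (v :: l).sum) =
        (1 + (-3 / 2) * τ + (1 / 2) * τ ^ 2) * h (x + τ • l.sum)
        + (0 + 2 * τ + (-1) * τ ^ 2) * h (x + v + τ • l.sum)
        + (0 + (-1 / 2) * τ + (1 / 2) * τ ^ 2) * h (x + (2 : ℂ) • v + τ • l.sum) := fun τ => by
      have := (H v List.mem_cons_self).eq (x + τ • l.sum) τ
      rw [List.sum_cons, smul_add, add_comm (τ • v), ← add_assoc, this,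
        add_right_comm x (τ • l.sum) v, add_right_comm x (τ • l.sum) ((2 : ℂ) • v)]
    rw [show 2 * (v :: l).length = 2 + 2 * l.length by rw [List.length_cons]; ring, funext key]
    exact (((isPolyLE_quadratic _ _ _).mul (ih' x)).add
      ((isPolyLE_quadratic _ _ _).mul (ih' _))).add ((isPolyLE_quadratic _ _ _).mul (ih' _))

lemma isPolyLE_along_add_list_sum (u : V) (l : List V) (h : V → ℂ) (Hu : AffineAlong h u)
    (H : ∀ v ∈ l, QuadraticAlong h v) (x : V) :
    IsPolyLE (1 + 2 * l.length) (fun τ => h (x + τ • (u + l.sum))) := by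
  have key : ∀ τ : ℂ, h (x + τ • (u + l.sum)) =
      (1 + (-1) * τ) * h (x + τ • l.sum) + (0 + 1 * τ) * h (x + u + τ • l.sum) := fun τ => by
    have := Hu.eq (x + τ • l.sum) τ
    rw [smul_add, add_comm (τ • u), ← add_assoc, this, add_right_comm x (τ • l.sum) u]
    ring
  rw [funext key]
  exact ((isPolyLE_affine _ _).mul (isPolyLE_along_list_sum l h H _)).add
    ((isPolyLE_affine _ _).mul (isPolyLE_along_list_sum l h H _))

/-- On the line ℂv the function is h(v)τ^D, whose degree is D unless h(v) = 0. -/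
lemma eq_zero_of_homogeneous_of_isPolyLE {h : V → ℂ} {D d : ℕ} {v : V}
    (hom : ∀ τ : ℂ, τ ≠ 0 → h (τ • v) = τ ^ D * h v)
    (hp : IsPolyLE d (fun τ => h (τ • v))) (hd : d < D) : h v = 0 := by
  obtain ⟨p, hp, hp'⟩ := hp
  have : p = .C (h v) * .X ^ D := by
    refine Polynomial.eq_of_infinite_eval_eq _ _
      ((Set.finite_singleton (0 : ℂ)).infinite_compl.mono fun τ hτ => ?_)
    have : h (τ • v) = p.eval τ := hp' τ
    rw [hom τ hτ] at this
    change p.eval τ = _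
    rw [← this, Polynomial.eval_mul, Polynomial.eval_C, Polynomial.eval_pow, Polynomial.eval_X,
      mul_comm]
  have hc := Polynomial.coeff_eq_zero_of_natDegree_lt (hp.trans_lt hd)
  simpa [this] using hc

end Lines

/-! ### Decomposition into sums of values of a bilinear map -/

section RankOne

variable {A B : Type*} [AddCommGroup A] [Module ℂ A] [AddCommGroup B] [Module ℂ B]

/-- Suppose all these ranks are at most one and take independent values β(p₁,p₂), β(q₁,q₂). The
cross value β(p₁,q₂) is proportional to both, so it is zero, and likewise β(q₁,p₂). Then β(p₁+q₁,·)
takes both independent values, a contradiction. -/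
lemma exists_two_le_finrank_range {V : Type*} [AddCommGroup V] [Module ℂ V]
    [FiniteDimensional ℂ V] (β : A →ₗ[ℂ] B →ₗ[ℂ] V)
    (hβ : Submodule.span ℂ (Set.range fun p : A × B => β p.1 p.2) = ⊤)
    (hV : 2 ≤ Module.finrank ℂ V) :
    (∃ z, 2 ≤ Module.finrank ℂ (LinearMap.range (β z))) ∨
      ∃ ζ, 2 ≤ Module.finrank ℂ (LinearMap.range (β.flip ζ)) := by
  have two : ∀ (W : Submodule ℂ V) (p q : V), p ∈ W → q ∈ W → LinearIndependent ℂ ![p, q] →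
      2 ≤ Module.finrank ℂ W := fun W p q hp hq hpq => by
    have h2 : LinearIndependent ℂ (![⟨p, hp⟩, ⟨q, hq⟩] : Fin 2 → W) := by
      refine LinearIndependent.of_comp W.subtype ?_
      convert hpq using 1
      ext i; fin_cases i <;> rfl
    simpa using h2.fintype_card_le_finrank
  by_contra hcon
  push Not at hcon
  obtain ⟨h1, h2⟩ := hcon
  obtain ⟨p, hp, hp0⟩ : ∃ p : A × B, True ∧ β p.1 p.2 ≠ 0 := by
    by_contra! hall
    have : (⊤ : Submodule ℂ V) ≤ ⊥ := by
      rw [← hβ, Submodule.span_le]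
      rintro _ ⟨p, rfl⟩
      exact hall p trivial
    have h0 : Module.finrank ℂ V = 0 := by
      rw [← finrank_top, le_bot_iff.mp this, finrank_bot]
    omega
  obtain ⟨q, hq⟩ : ∃ q : A × B, β q.1 q.2 ∉ Submodule.span ℂ {β p.1 p.2} := by
    by_contra! hall
    have : (⊤ : Submodule ℂ V) ≤ Submodule.span ℂ {β p.1 p.2} := by
      rw [← hβ, Submodule.span_le]
      rintro _ ⟨q, rfl⟩
      exact hall q
    have h0 : Module.finrank ℂ V ≤ 1 := by
      rw [← finrank_top ℂ V, ← top_le_iff.mp this]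
      exact finrank_span_singleton hp0 |>.le
    omega
  have indep : LinearIndependent ℂ ![β p.1 p.2, β q.1 q.2] := by
    rw [LinearIndependent.pair_iff' hp0]
    intro a ha
    exact hq (ha ▸ Submodule.smul_mem _ _ (Submodule.mem_span_singleton_self _))
  have dep : ∀ x, (LinearIndependent ℂ ![β p.1 p.2, x] → False) →
      (LinearIndependent ℂ ![x, β q.1 q.2] → False) → x = 0 := fun x hx hx' => by
    by_contra hx0
    rw [LinearIndependent.pair_iff' hp0] at hx
    rw [LinearIndependent.pair_iff' hx0] at hx'
    simp only [imp_false, not_forall, not_not] at hx hx'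
    obtain ⟨a, rfl⟩ := hx
    obtain ⟨b, hb⟩ := hx'
    exact hq (by
      rw [← hb]
      exact Submodule.smul_mem _ _ (Submodule.smul_mem _ _ (Submodule.mem_span_singleton_self _)))
  have e1 : β p.1 q.2 = 0 := dep _
    (fun h => absurd (two (LinearMap.range (β p.1)) _ _ ⟨_, rfl⟩ ⟨_, rfl⟩ h) (h1 _).not_ge)
    (fun h => absurd (two (LinearMap.range (β.flip q.2)) _ _ ⟨p.1, rfl⟩ ⟨q.1, rfl⟩ h)
      (h2 _).not_ge)
  have e2 : β q.1 p.2 = 0 := dep _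
    (fun h => absurd (two (LinearMap.range (β.flip p.2)) _ _ ⟨p.1, rfl⟩ ⟨q.1, rfl⟩ h)
      (h2 _).not_ge)
    (fun h => absurd (two (LinearMap.range (β q.1)) _ _ ⟨_, rfl⟩ ⟨_, rfl⟩ h) (h1 _).not_ge)
  refine absurd (two (LinearMap.range (β (p.1 + q.1))) _ _ ⟨p.2, ?_⟩ ⟨q.2, ?_⟩ indep) (h1 _).not_ge
  · simp [e2]
  · simp [e1]

/-- Every vector is congruent modulo `U` to a sum of at most `(codim U + 1) / 2` values of `β`. -/
lemma exists_list_sum_sub_mem {V : Type*} [AddCommGroup V] [Module ℂ V]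
    [FiniteDimensional ℂ V] (β : A →ₗ[ℂ] B →ₗ[ℂ] V)
    (hβ : Submodule.span ℂ (Set.range fun p : A × B => β p.1 p.2) = ⊤)
    (U : Submodule ℂ V) (v : V) :
    ∃ l : List (A × B), 2 * l.length ≤ Module.finrank ℂ (V ⧸ U) + 1 ∧
      v - (l.map fun p => β p.1 p.2).sum ∈ U := by
  induction hN : Module.finrank ℂ (V ⧸ U) using Nat.strong_induction_on generalizing U with
  | _ N ih =>
  set β' : A →ₗ[ℂ] B →ₗ[ℂ] (V ⧸ U) := β.compr₂ U.mkQ with hβ'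
  have hspan : Submodule.span ℂ (Set.range fun p : A × B => β' p.1 p.2) = ⊤ := by
    have : (Set.range fun p : A × B => β' p.1 p.2) =
        U.mkQ '' (Set.range fun p : A × B => β p.1 p.2) := by
      rw [← Set.range_comp]; rfl
    rw [this, ← Submodule.map_span, hβ, Submodule.map_top, Submodule.range_mkQ]
  rcases Nat.lt_or_ge N 2 with hlt | hge
  · by_cases hmem : v ∈ U
    · exact ⟨[], by simp, by simpa using hmem⟩
    have hv0 : U.mkQ v ≠ 0 := by simpa using hmem
    have hN1 : Module.finrank ℂ (V ⧸ U) = 1 := by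
      have : 0 < Module.finrank ℂ (V ⧸ U) := Module.finrank_pos_iff_exists_ne_zero.mpr ⟨_, hv0⟩
      omega
    -- In codimension one any nonzero value spans the quotient, and rescaling its first argument
    -- reaches the class of v.
    obtain ⟨p, hp⟩ : ∃ p : A × B, β' p.1 p.2 ≠ 0 := by
      by_contra! hall
      have : (⊤ : Submodule ℂ (V ⧸ U)) ≤ ⊥ := by
        rw [← hspan, Submodule.span_le]
        rintro _ ⟨p, rfl⟩
        exact hall p
      exact hv0 (this trivial)
    obtain ⟨c, hc⟩ := exists_smul_eq_of_finrank_eq_one hN1 hp (U.mkQ v)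
    refine ⟨[(c • p.1, p.2)], by simp; omega, ?_⟩
    have : U.mkQ (v - β (c • p.1) p.2) = 0 := by
      rw [map_sub, sub_eq_zero, ← hc]
      simp [hβ']
    simpa [Submodule.Quotient.mk_eq_zero] using (Submodule.Quotient.mk_eq_zero U).mp this
  -- If W consists of values of β, enlarging U by W costs a single summand and lowers the
  -- codimension by at least two.
  · have step : ∀ W : Submodule ℂ V,
        2 ≤ Module.finrank ℂ (W.map U.mkQ) → (∀ w ∈ W, ∃ p : A × B, w = β p.1 p.2) →
        ∃ l : List (A × B), 2 * l.length ≤ N + 1 ∧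
          v - (l.map fun p => β p.1 p.2).sum ∈ U := by
      intro W hW hW'
      have hdim : Module.finrank ℂ (V ⧸ (U ⊔ W)) + 2 ≤ N := by
        have e1 := Submodule.finrank_quotient_add_finrank (W.map U.mkQ)
        have e2 : Module.finrank ℂ ((V ⧸ U) ⧸ (W.map U.mkQ)) =
            Module.finrank ℂ (V ⧸ (U ⊔ W)) := by
          have hcomap : (U ⊔ W) = (W.map U.mkQ).comap U.mkQ := by
            rw [Submodule.comap_map_eq, Submodule.ker_mkQ, sup_comm]
          have hm : (U ⊔ W).map U.mkQ = W.map U.mkQ := by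
            simp [Submodule.map_sup]
          rw [← hm]
          exact (Submodule.quotientQuotientEquivQuotient U (U ⊔ W) le_sup_left).finrank_eq
        omega
      obtain ⟨l, hl, hmem⟩ := ih _ (by omega) (U ⊔ W) rfl
      obtain ⟨u, hu, w, hw, huw⟩ := Submodule.mem_sup.mp hmem
      obtain ⟨p, hp⟩ := hW' w hw
      refine ⟨p :: l, by simp only [List.length_cons]; omega, ?_⟩
      have : v - ((p :: l).map fun p => β p.1 p.2).sum = u := by
        rw [List.map_cons, List.sum_cons, ← hp, add_comm, ← sub_sub, ← huw]
        abel
      rwa [this]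
    rcases exists_two_le_finrank_range β' hspan (hN ▸ hge) with ⟨z, hz⟩ | ⟨ζ, hζ⟩
    · refine step (LinearMap.range (β z)) ?_ ?_
      · have : (LinearMap.range (β z)).map U.mkQ = LinearMap.range (β' z) := by
          rw [← LinearMap.range_comp]; rfl
        rwa [this]
      · rintro _ ⟨ζ, rfl⟩
        exact ⟨(z, ζ), rfl⟩
    · refine step (LinearMap.range (β.flip ζ)) ?_ ?_
      · have : (LinearMap.range (β.flip ζ)).map U.mkQ = LinearMap.range (β'.flip ζ) := by
          rw [← LinearMap.range_comp]; rfl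
        rwa [this]
      · rintro _ ⟨z, rfl⟩
        exact ⟨(z, ζ), rfl⟩

end RankOne

/-! ### Linear families of functions that are affine along the values of a bilinear map -/

section Family

variable {A B V : Type*} [AddCommGroup A] [Module ℂ A] [AddCommGroup B] [Module ℂ B]
  [NormedAddCommGroup V] [NormedSpace ℂ V]

lemma hasDerivAt_line {h : V → ℂ} (hh : Differentiable ℂ h) (x v : V) :
    HasDerivAt (fun ε : ℂ => h (x + ε • v)) (fderiv ℂ h x v) 0 := by
  have h1 : HasFDerivAt h (fderiv ℂ h x) (x + (0 : ℂ) • v) := by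
    simpa using (hh x).hasFDerivAt
  have h2 : HasDerivAt (fun ε : ℂ => x + ε • v) v 0 := by
    simpa using ((hasDerivAt_id (0 : ℂ)).smul_const v).const_add x
  exact h1.comp_hasDerivAt 0 h2

/-- Differentiate at ε = 0 the affinity of Ψ(z+εc) along β(z+εc,ζ) = v + εv'. This shows that
Ψ_c(x+τv) + τ ∂_{v'}Ψ_z(x+τv) is affine in τ. The derivative ∂_{v'}Ψ_z is affine along v because Ψ_z
is, which leaves a quadratic expression for Ψ_c. -/
lemma quadraticAlong_of_affineAlong (β : A →ₗ[ℂ] B →ₗ[ℂ] V) (Ψ : A →ₗ[ℂ] V → ℂ)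
    (hd : ∀ c, Differentiable ℂ (Ψ c)) (ha : ∀ c ζ, AffineAlong (Ψ c) (β c ζ)) (c z : A) (ζ : B) :
    QuadraticAlong (Ψ c) (β z ζ) := by
  intro x
  set v := β z ζ with hv
  set v' := β c ζ with hv'
  have hD : ∀ τ : ℂ, fderiv ℂ (Ψ z) (x + τ • v) v' =
      (1 - τ) * fderiv ℂ (Ψ z) x v' + τ * fderiv ℂ (Ψ z) (x + v) v' := fun τ => by
    refine (hasDerivAt_line (hd z) (x + τ • v) v').unique ?_
    refine (((hasDerivAt_line (hd z) x v').const_mul (1 - τ)).add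
      ((hasDerivAt_line (hd z) (x + v) v').const_mul τ)).congr_of_eventuallyEq
      (Eventually.of_forall fun ε => ?_)
    have := (ha z ζ).eq (x + ε • v') τ
    rw [← hv, add_right_comm, add_right_comm x _ v] at this
    exact this
  have hcont : ∀ y, HasDerivAt (fun ε : ℂ => ε * Ψ c (y + ε • v')) (Ψ c y) 0 := fun y =>
    ((hasDerivAt_id (0 : ℂ)).mul (hasDerivAt_line (hd c) y v')).congr_deriv (by simp)
  have hcont' : ∀ (y : V) (τ : ℂ),
      HasDerivAt (fun ε : ℂ => ε * Ψ c (y + ε • τ • v')) (Ψ c y) 0 := fun y τ =>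
    ((hasDerivAt_id (0 : ℂ)).mul (hasDerivAt_line (hd c) y (τ • v'))).congr_deriv (by simp)
  have key : ∀ τ : ℂ, fderiv ℂ (Ψ z) (x + τ • v) (τ • v') + Ψ c (x + τ • v) =
      (1 - τ) * (0 + Ψ c x) + τ * (fderiv ℂ (Ψ z) (x + v) v' + Ψ c (x + v)) := fun τ => by
    refine ((hasDerivAt_line (hd z) (x + τ • v) (τ • v')).add
      (hcont' (x + τ • v) τ)).unique ?_
    have h0 : HasDerivAt (fun ε : ℂ => Ψ z x + ε * Ψ c x) (0 + Ψ c x) 0 := by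
      simpa using ((hasDerivAt_id (0 : ℂ)).mul_const (Ψ c x)).const_add (Ψ z x)
    refine ((h0.const_mul (1 - τ)).add (((hasDerivAt_line (hd z) (x + v) v').add
      (hcont (x + v))).const_mul τ)).congr_of_eventuallyEq (Eventually.of_forall fun ε => ?_)
    have := (ha (z + ε • c) ζ).eq x τ
    simp only [map_add, map_smul, LinearMap.add_apply, LinearMap.smul_apply, Pi.add_apply,
      Pi.smul_apply, smul_eq_mul, ← hv, ← hv'] at this
    rw [smul_add, smul_comm τ ε, ← add_assoc, ← add_assoc] at this
    exact this
  refine ⟨Ψ c x, fderiv ℂ (Ψ z) (x + v) v' + Ψ c (x + v) - Ψ c x - fderiv ℂ (Ψ z) x v',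
    fderiv ℂ (Ψ z) x v' - fderiv ℂ (Ψ z) (x + v) v', fun τ => ?_⟩
  have h1 := key τ
  rw [map_smul, smul_eq_mul, hD] at h1
  linear_combination h1

variable [FiniteDimensional ℂ V]

/-- Lower semicontinuity of rank: finitely many independent values stay independent under small
perturbations. -/
lemma eventually_le_finrank_range (β : A →ₗ[ℂ] B →ₗ[ℂ] V) (c₀ c : A) (r : ℕ)
    (h : r ≤ Module.finrank ℂ (LinearMap.range (β c₀))) :
    ∀ᶠ ε in 𝓝 (0 : ℂ), r ≤ Module.finrank ℂ (LinearMap.range (β (c₀ + ε • c))) := by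
  obtain ⟨u, hu⟩ := exists_linearIndependent_of_le_finrank h
  choose ζ hζ using fun i => (u i).2
  have hind : LinearIndependent ℂ (fun i => β c₀ (ζ i)) := by
    simp only [hζ]
    exact hu.map' _ (Submodule.ker_subtype _)
  have htend : Tendsto (fun ε : ℂ => fun i => β c₀ (ζ i) + ε • β c (ζ i)) (𝓝 0)
      (𝓝 (fun i => β c₀ (ζ i))) := by
    have : Continuous (fun ε : ℂ => fun i => β c₀ (ζ i) + ε • β c (ζ i)) := by fun_prop
    simpa using this.tendsto 0
  filter_upwards [htend.eventually hind.eventually] with ε hε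
  have h2 : LinearIndependent ℂ
      (fun i => (⟨β (c₀ + ε • c) (ζ i), _, rfl⟩ : LinearMap.range (β (c₀ + ε • c)))) := by
    refine LinearIndependent.of_comp (LinearMap.range (β (c₀ + ε • c))).subtype ?_
    have e : (LinearMap.range (β (c₀ + ε • c))).subtype ∘
        (fun i => (⟨β (c₀ + ε • c) (ζ i), _, rfl⟩ : LinearMap.range (β (c₀ + ε • c)))) =
        fun i => β c₀ (ζ i) + ε • β c (ζ i) := by
      ext i
      simp
    rw [e]
    exact hε
  simpa using h2.fintype_card_le_finrank

/-- When β(c,·) has sufficient rank, v is one vector of its range, along which Ψ_c is affine, plus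
few values of β, along which Ψ_c is quadratic; the degree on ℂv is then below D. Such c are dense
enough that linearity of Ψ in c covers the rest. -/
lemma eq_zero_of_affineAlong_of_homogeneous (β : A →ₗ[ℂ] B →ₗ[ℂ] V)
    (hβ : Submodule.span ℂ (Set.range fun p : A × B => β p.1 p.2) = ⊤)
    (hV : 0 < Module.finrank ℂ V)
    (hc₀ : ∃ c₀, min 2 (Module.finrank ℂ V) ≤ Module.finrank ℂ (LinearMap.range (β c₀)))
    (Ψ : A →ₗ[ℂ] V → ℂ)
    (hd : ∀ c, Differentiable ℂ (Ψ c)) (ha : ∀ c ζ, AffineAlong (Ψ c) (β c ζ))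
    {D : ℕ} (hD : Module.finrank ℂ V < D)
    (hom : ∀ c v (τ : ℂ), τ ≠ 0 → Ψ c (τ • v) = τ ^ D * Ψ c v) : Ψ = 0 := by
  have good : ∀ c, min 2 (Module.finrank ℂ V) ≤ Module.finrank ℂ (LinearMap.range (β c)) →
      Ψ c = 0 := fun c hc => by
    ext v
    obtain ⟨l, hl, ζ, hζ⟩ := exists_list_sum_sub_mem β hβ (LinearMap.range (β c)) v
    have hfin := Submodule.finrank_quotient_add_finrank (LinearMap.range (β c))
    have hv : v = β c ζ + (l.map fun p => β p.1 p.2).sum := by rw [hζ]; abel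
    -- With d = dim V and r the rank of β(c,·), 1 + 2|l| ≤ d − r + 2, which is at most d if r ≥ 2.
    -- If d = 1, then r = 1, the list is empty and the degree is at most 1.
    refine eq_zero_of_homogeneous_of_isPolyLE (hom c v) (d := 1 + 2 * l.length) ?_ (by omega)
    have := isPolyLE_along_add_list_sum (β c ζ) (l.map fun p => β p.1 p.2) (Ψ c) (ha c ζ)
      (fun w hw => by
        obtain ⟨p, -, rfl⟩ := List.mem_map.mp hw
        exact quadraticAlong_of_affineAlong β Ψ hd ha c p.1 p.2) 0
    simpa [← hv] using this
  obtain ⟨c₀, hc₀⟩ := hc₀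
  refine LinearMap.ext fun c => ?_
  have hev := (eventually_le_finrank_range β c₀ c _ hc₀).filter_mono
    (nhdsWithin_le_nhds (s := {0}ᶜ))
  obtain ⟨ε, hε, hε0⟩ := (hev.and eventually_mem_nhdsWithin).exists
  have h1 := good _ hε
  rw [map_add, map_smul, good c₀ hc₀, zero_add] at h1
  simpa using (smul_eq_zero.mp h1).resolve_left hε0

end Family

/-! ### The complexified form -/

section Form

variable {n k : ℕ}

/-- The complex bilinear form with coefficient matrices `H₁, …, Hₖ`. -/
def bil (H : Fin k → Matrix (Fin n) (Fin n) ℂ) :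
    (Fin n → ℂ) →ₗ[ℂ] (Fin n → ℂ) →ₗ[ℂ] (Fin k → ℂ) :=
  LinearMap.mk₂ ℂ (fun z ζ j => ∑ a, ∑ b, H j a b * z a * ζ b)
    (fun z z' ζ => by ext j; simp [mul_add, add_mul, Finset.sum_add_distrib])
    (fun c z ζ => by
      ext j
      simp only [Pi.smul_apply, smul_eq_mul, Finset.mul_sum]
      exact Finset.sum_congr rfl fun a _ => Finset.sum_congr rfl fun b _ => by ring)
    (fun z ζ ζ' => by ext j; simp [mul_add, Finset.sum_add_distrib])
    (fun c z ζ => by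
      ext j
      simp only [Pi.smul_apply, smul_eq_mul, Finset.mul_sum]
      exact Finset.sum_congr rfl fun a _ => Finset.sum_congr rfl fun b _ => by ring)

variable (H : Fin k → Matrix (Fin n) (Fin n) ℂ)

lemma bil_apply (z ζ : Fin n → ℂ) (j : Fin k) :
    bil H z ζ j = ∑ a, ∑ b, H j a b * z a * ζ b := rfl

lemma form_eq_bil (z ζ : Fin n → ℂ) : form H z ζ = bil H z (star ζ) := rfl

variable {H}

lemma star_bil (hH : ∀ j, (H j).IsHermitian) (z ζ : Fin n → ℂ) :
    star (bil H z ζ) = bil H (star ζ) (star z) := by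
  ext j
  simp only [Pi.star_apply, bil_apply, star_sum, star_mul']
  rw [Finset.sum_comm]
  refine Finset.sum_congr rfl fun b _ => Finset.sum_congr rfl fun a _ => ?_
  have : star (H j a b) = H j b a := (hH j).apply b a
  rw [this]
  ring

lemma eq_zero_of_bil_left (hH : Nondegenerate H) {e : Fin n → ℂ} (h : ∀ ζ, bil H e ζ = 0) :
    e = 0 := hH.no_kernel e fun z => h (star z)

lemma eq_of_bil_left (hH : Nondegenerate H) {e e' : Fin n → ℂ}
    (h : ∀ ζ, bil H e ζ = bil H e' ζ) : e = e' :=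
  sub_eq_zero.mp (eq_zero_of_bil_left hH fun ζ => by simp [h])

lemma eq_zero_of_bil_right (hH : Nondegenerate H) {e : Fin n → ℂ} (h : ∀ z, bil H z e = 0) :
    e = 0 := by
  refine star_eq_zero.mp (eq_zero_of_bil_left hH fun ζ => ?_)
  rw [← star_star ζ, ← star_bil hH.hermitian, h, star_zero]

/-- Since the matrices are Hermitian, conjugating a relation with coefficients cⱼ gives one with
coefficients c̄ⱼ, so the real and imaginary parts are real relations. -/
lemma linearIndependent_complex (hH : Nondegenerate H) : LinearIndependent ℂ H := by
  rw [Fintype.linearIndependent_iff]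
  intro c hc
  have hR := Fintype.linearIndependent_iff.mp hH.linearIndependent
  have hentry : ∀ a b, ∑ j, c j * H j a b = 0 := fun a b => by
    simpa [Matrix.sum_apply] using congrFun (congrFun hc a) b
  have hconj : ∀ a b, ∑ j, star (c j) * H j a b = 0 := fun a b => by
    have := congrArg star (hentry b a)
    rw [star_sum, star_zero] at this
    rw [← this]
    refine Finset.sum_congr rfl fun j _ => ?_
    rw [star_mul', (hH.hermitian j).apply a b]
  have hre : ∀ j, (c j).re = 0 := hR (fun j => (c j).re) <| by
    ext a b
    simp only [Matrix.sum_apply, Matrix.smul_apply, Matrix.zero_apply, Complex.real_smul]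
    have : ∀ j, ((c j).re : ℂ) * H j a b = (1 / 2) * (c j * H j a b + star (c j) * H j a b) :=
      fun j => by
        rw [Complex.re_eq_add_conj, ← starRingEnd_apply]
        ring
    simp only [this, ← Finset.mul_sum, Finset.sum_add_distrib, hentry, hconj, add_zero, mul_zero]
  have him : ∀ j, (c j).im = 0 := hR (fun j => (c j).im) <| by
    ext a b
    simp only [Matrix.sum_apply, Matrix.smul_apply, Matrix.zero_apply, Complex.real_smul]
    have : ∀ j, ((c j).im : ℂ) * H j a b =
        (1 / (2 * Complex.I)) * (c j * H j a b - star (c j) * H j a b) :=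
      fun j => by
        rw [Complex.im_eq_sub_conj, ← starRingEnd_apply]
        ring
    simp only [this, ← Finset.mul_sum, Finset.sum_sub_distrib, hentry, hconj, sub_zero, mul_zero]
  exact fun j => Complex.ext (hre j) (him j)

/-- A functional that kills all values of β is a complex linear relation between the Hⱼ. -/
lemma span_range_bil (hH : Nondegenerate H) :
    Submodule.span ℂ (Set.range fun p : (Fin n → ℂ) × (Fin n → ℂ) => bil H p.1 p.2) = ⊤ := by
  classical
  by_contra hne
  obtain ⟨φ, hφ, hle⟩ := Submodule.exists_le_ker_of_lt_top _ (lt_top_iff_ne_top.mpr hne)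
  have hφ' : ∀ v : Fin k → ℂ, φ v = ∑ j, v j * φ (Pi.single j 1) := fun v => by
    conv_lhs => rw [pi_eq_sum_univ' v]
    simp [map_sum, Pi.single]
  have hzero := Fintype.linearIndependent_iff.mp (linearIndependent_complex hH)
    (fun j => φ (Pi.single j 1)) <| by
      ext a b
      have : φ (bil H (Pi.single a 1) (Pi.single b 1)) = 0 :=
        hle (Submodule.subset_span ⟨(_, _), rfl⟩)
      rw [hφ'] at this
      simpa [bil_apply, Pi.single_apply, Matrix.sum_apply, mul_comm] using this
  exact hφ (LinearMap.ext fun v => by rw [hφ' v]; simp [hzero])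

/-- Conjugation exchanges the two arguments of β, so a large range of β(·,ζ) yields a large range of
β(ζ̄,·). -/
lemma exists_min_two_le_finrank_range_bil (hH : Nondegenerate H) :
    ∃ c₀, min 2 (Module.finrank ℂ (Fin k → ℂ)) ≤
      Module.finrank ℂ (LinearMap.range (bil H c₀)) := by
  rcases Nat.lt_or_ge (Module.finrank ℂ (Fin k → ℂ)) 2 with hlt | hge
  · by_contra! hall
    have h0 : ∀ c, bil H c = 0 := fun c => by
      have h1 := hall c
      have : Module.finrank ℂ (LinearMap.range (bil H c)) = 0 := by omega
      rw [Submodule.finrank_eq_zero, LinearMap.range_eq_bot] at this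
      exact this
    have hspan := span_range_bil hH
    simp only [h0, LinearMap.zero_apply] at hspan
    have : (⊤ : Submodule ℂ (Fin k → ℂ)) ≤ ⊥ := by
      rw [← hspan, Submodule.span_le]
      rintro _ ⟨p, rfl⟩
      simp
    have h2 := hall 0
    rw [← finrank_top ℂ (Fin k → ℂ), le_bot_iff.mp this, finrank_bot] at h2
    omega
  · rw [min_eq_left hge]
    rcases exists_two_le_finrank_range _ (span_range_bil hH) hge with h | ⟨ζ, hζ⟩
    · exact h
    · refine ⟨star ζ, ?_⟩
      obtain ⟨u, hu⟩ := exists_linearIndependent_of_le_finrank hζ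
      choose z hz using fun i => (u i).2
      have hind : LinearIndependent ℂ (fun i => bil H (z i) ζ) := by
        have : (fun i => bil H (z i) ζ) = Submodule.subtype _ ∘ u := by
          ext1 i
          exact hz i
        rw [this]
        exact hu.map' _ (Submodule.ker_subtype _)
      have hind' : LinearIndependent ℂ (fun i => bil H (star ζ) (star (z i))) := by
        rw [Fintype.linearIndependent_iff] at hind ⊢
        intro c hc i
        have := hind (fun i => star (c i)) (by
          have h3 := congrArg star hc
          simpa [star_sum, star_smul, star_bil hH.hermitian] using h3) i
        simpa using this
      have h2 : LinearIndependent ℂ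
          (fun i => (⟨bil H (star ζ) (star (z i)), _, rfl⟩ :
            LinearMap.range (bil H (star ζ)))) :=
        LinearIndependent.of_comp (LinearMap.range (bil H (star ζ))).subtype hind'
      simpa using h2.fintype_card_le_finrank

lemma differentiable_bil {E : Type*} [NormedAddCommGroup E] [NormedSpace ℂ E]
    {f g : E → Fin n → ℂ} (hf : Differentiable ℂ f) (hg : Differentiable ℂ g) :
    Differentiable ℂ (fun x => bil H (f x) (g x)) := by
  rw [differentiable_pi]
  intro j
  simp only [bil_apply]
  fun_prop

end Form

/-! ### Complexification of the tangency condition -/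

section Complexification

variable {n k : ℕ} {H : Fin k → Matrix (Fin n) (Fin n) ℂ}

/-- The tangency condition `Im g = 2 Re ⟨f, z̄⟩` at all points of the quadric. -/
def IsTangent (H : Fin k → Matrix (Fin n) (Fin n) ℂ) (F : Amb n k → Amb n k) : Prop :=
  ∀ p ∈ quadric H, ∀ j, ((F p).2 j).im = 2 * (bil H (F p).1 (star p.1) j).re

/-- The field with complex conjugate coefficients. -/
def conjField (F : Amb n k → Amb n k) (p : Amb n k) : Amb n k := star (F (star p))

lemma differentiable_conjField {F : Amb n k → Amb n k} (hF : Differentiable ℂ F) :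
    Differentiable ℂ (conjField F) := fun p => by
  have := (hF (star p)).star_star
  rwa [star_star] at this

lemma mem_quadric_iff (p : Amb n k) :
    p ∈ quadric H ↔ ∀ j, (p.2 j).im = (bil H p.1 (star p.1) j).re := by
  simp only [quadric, Set.mem_ofPred_eq, funext_iff, defFun, Pi.zero_apply, sub_eq_zero,
    form_eq_bil]

/-- The points (z, z̄, u) with u real form a totally real subspace of full dimension. The complex
line γ meets it for all real s and passes through the given point at s = i, so the one-variable
identity theorem applies. -/
lemma eq_zero_of_real_points {G : ((Fin n → ℂ) × (Fin n → ℂ) × (Fin k → ℂ)) → (Fin k → ℂ)}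
    (hG : Differentiable ℂ G) (h : ∀ z u, star u = u → G (z, star z, u) = 0)
    (z ζ : Fin n → ℂ) (u : Fin k → ℂ) : G (z, ζ, u) = 0 := by
  set γ : ℂ → (Fin n → ℂ) × (Fin n → ℂ) × (Fin k → ℂ) := fun s =>
    ((1 / 2 : ℂ) • (z + star ζ) + (s * (-Complex.I / 2)) • (z - star ζ),
      (1 / 2 : ℂ) • (ζ + star z) + (s * (-Complex.I / 2)) • (ζ - star z),
      (1 / 2 : ℂ) • (u + star u) + (s * (-Complex.I / 2)) • (u - star u)) with hγ
  have hγd : Differentiable ℂ γ := by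
    simp only [hγ]
    fun_prop
  have hreal : ∀ s : ℝ, G (γ s) = 0 := fun s => by
    have e1 : star ((1 / 2 : ℂ) • (z + star ζ) + ((s : ℂ) * (-Complex.I / 2)) • (z - star ζ)) =
        (1 / 2 : ℂ) • (ζ + star z) + ((s : ℂ) * (-Complex.I / 2)) • (ζ - star z) := by
      ext a
      simp
      ring
    have := h ((1 / 2 : ℂ) • (z + star ζ) + ((s : ℂ) * (-Complex.I / 2)) • (z - star ζ))
      ((1 / 2 : ℂ) • (u + star u) + ((s : ℂ) * (-Complex.I / 2)) • (u - star u)) (by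
        ext a
        simp
        ring)
    rwa [e1] at this
  have han : AnalyticOnNhd ℂ (fun s => G (γ s)) Set.univ := fun s _ =>
    (hG.comp hγd).analyticAt s
  have hfreq : ∃ᶠ s in 𝓝[≠] (0 : ℂ), G (γ s) = 0 := by
    have ht : Tendsto (fun s : ℝ => (s : ℂ)) (𝓝[≠] 0) (𝓝[≠] 0) := by
      refine tendsto_nhdsWithin_iff.mpr ⟨?_, ?_⟩
      · exact (Complex.continuous_ofReal.tendsto' 0 0 (by simp)).mono_left nhdsWithin_le_nhds
      · filter_upwards [self_mem_nhdsWithin] with s hs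
        simpa using hs
    exact ht.frequently (Eventually.of_forall hreal).frequently
  have := congrFun (han.eq_of_frequently_eq (g := fun _ => 0) (fun _ _ => analyticAt_const)
    hfreq) Complex.I
  have e : γ Complex.I = (z, ζ, u) := by
    simp only [hγ, Prod.mk.injEq]
    have : Complex.I * (-Complex.I / 2) = 1 / 2 := by
      rw [mul_div_assoc', mul_neg, Complex.I_mul_I, neg_neg]
    rw [this]
    refine ⟨?_, ?_, ?_⟩ <;> · ext a; simp; ring
  rwa [e] at this

/-- Parametrize w = u + iβ(z,ζ), w' = u − iβ(z,ζ). The difference of the two sides is entire in (z,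
ζ, u), and for ζ = z̄ with u real it vanishes by tangency at a point of the quadric. -/
lemma complexified (hH : ∀ j, (H j).IsHermitian) {F : Amb n k → Amb n k}
    (hF : Differentiable ℂ F) (hT : IsTangent H F) (z ζ : Fin n → ℂ) (w w' : Fin k → ℂ)
    (hw : w - w' = (2 * Complex.I) • bil H z ζ) :
    (F (z, w)).2 - (conjField F (ζ, w')).2 =
      (2 * Complex.I) • (bil H (F (z, w)).1 ζ + bil H z (conjField F (ζ, w')).1) := by
  set G : ((Fin n → ℂ) × (Fin n → ℂ) × (Fin k → ℂ)) → (Fin k → ℂ) := fun q =>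
    (F (q.1, q.2.2 + Complex.I • bil H q.1 q.2.1)).2 -
      (conjField F (q.2.1, q.2.2 - Complex.I • bil H q.1 q.2.1)).2 -
      (2 * Complex.I) • (bil H (F (q.1, q.2.2 + Complex.I • bil H q.1 q.2.1)).1 q.2.1 +
        bil H q.1 (conjField F (q.2.1, q.2.2 - Complex.I • bil H q.1 q.2.1)).1) with hG
  have hGd : Differentiable ℂ G := by
    have hb : Differentiable ℂ (fun q : (Fin n → ℂ) × (Fin n → ℂ) × (Fin k → ℂ) =>
      bil H q.1 q.2.1) := differentiable_bil (by fun_prop) (by fun_prop)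
    have hF' := differentiable_conjField hF
    have h1 : Differentiable ℂ (fun q : (Fin n → ℂ) × (Fin n → ℂ) × (Fin k → ℂ) =>
      F (q.1, q.2.2 + Complex.I • bil H q.1 q.2.1)) := by fun_prop
    have h2 : Differentiable ℂ (fun q : (Fin n → ℂ) × (Fin n → ℂ) × (Fin k → ℂ) =>
      conjField F (q.2.1, q.2.2 - Complex.I • bil H q.1 q.2.1)) := by fun_prop
    have h3 := differentiable_bil (H := H) h1.fst differentiable_snd.fst
    have h4 := differentiable_bil (H := H) differentiable_fst h2.fst
    exact (h1.snd.sub h2.snd).sub ((h3.add h4).const_smul (2 * Complex.I))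
  have hGr : ∀ z u, star u = u → G (z, star z, u) = 0 := fun z u hu => by
    set p : Amb n k := (z, u + Complex.I • bil H z (star z)) with hp
    have hb : star (bil H z (star z)) = bil H z (star z) := by
      rw [star_bil hH, star_star]
    have hsp : star p = (star z, u - Complex.I • bil H z (star z)) := by
      simp only [hp, Prod.star_def, star_add, star_smul, hb, hu, Complex.star_def,
        Complex.conj_I, neg_smul, sub_eq_add_neg]
    have hcp : conjField F (star z, u - Complex.I • bil H z (star z)) = star (F p) := by
      rw [← hsp, conjField, star_star]
    have hpQ : p ∈ quadric H := by
      rw [mem_quadric_iff]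
      intro j
      have hu' : (u j).im = 0 := Complex.conj_eq_iff_im.mp (congrFun hu j)
      simp [hp, hu']
    have hT' := hT p hpQ
    have hb2 : bil H z (star (F p)).1 = star (bil H (F p).1 (star z)) := by
      rw [star_bil hH, star_star]; rfl
    simp only [hG, hcp, ← hp, hb2]
    ext j
    have hj := hT' j
    rw [show p.1 = z from rfl] at hj
    simp only [Pi.sub_apply, Pi.smul_apply, Pi.add_apply, Pi.star_apply, Pi.zero_apply,
      smul_eq_mul, Prod.snd_star, Complex.star_def]
    rw [Complex.add_conj, Complex.sub_conj, hj]
    push_cast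
    ring
  have key := eq_zero_of_real_points hGd hGr z ζ (w - Complex.I • bil H z ζ)
  have e : w - Complex.I • bil H z ζ - Complex.I • bil H z ζ = w' := by
    rw [sub_sub, ← add_smul, ← two_mul, ← hw]
    abel
  simp only [hG, sub_add_cancel, e] at key
  exact sub_eq_zero.mp key

end Complexification

/-! ### Dependence of tangent fields on `z` -/

section Structure

variable {n k : ℕ} {H : Fin k → Matrix (Fin n) (Fin n) ℂ} {F : Amb n k → Amb n k}

lemma conjField_snd_zero (hH : ∀ j, (H j).IsHermitian)
    (hF : Differentiable ℂ F) (hT : IsTangent H F) (w : Fin k → ℂ) :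
    (conjField F (0, w)).2 = (F (0, w)).2 := by
  have := complexified hH hF hT 0 0 w w (by simp)
  simp only [map_zero, LinearMap.zero_apply, add_zero, smul_zero] at this
  exact (sub_eq_zero.mp this).symm

lemma snd_eq (hH : ∀ j, (H j).IsHermitian)
    (hF : Differentiable ℂ F) (hT : IsTangent H F) (z : Fin n → ℂ) (w : Fin k → ℂ) :
    (F (z, w)).2 = (F (0, w)).2 + (2 * Complex.I) • bil H z (conjField F (0, w)).1 := by
  have := complexified hH hF hT z 0 w w (by simp)
  rw [conjField_snd_zero hH hF hT] at this
  rw [← sub_eq_iff_eq_add', this]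
  simp

/-- Replace ζ by εζ in the complexified identity and differentiate at ε = 0. The argument w' = w −
2iεβ(z,ζ) contributes a term linear in z, and pairing the derivative of f̄ with z once more gives
the quadratic term. -/
lemma exists_bil_fst_eq (hH : ∀ j, (H j).IsHermitian)
    (hF : Differentiable ℂ F) (hT : IsTangent H F) (w : Fin k → ℂ) (ζ : Fin n → ℂ) :
    ∃ (A₀ : Fin k → ℂ) (A₁ : (Fin n → ℂ) →ₗ[ℂ] (Fin k → ℂ))
      (A₂ : (Fin n → ℂ) →ₗ[ℂ] (Fin n → ℂ) →ₗ[ℂ] (Fin k → ℂ)),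
      ∀ z, bil H (F (z, w)).1 ζ = A₀ + A₁ z + A₂ z z := by
  set L := fderiv ℂ (conjField F) (0, w) with hL
  have hLd : HasFDerivAt (conjField F) L (0, w) :=
    (differentiable_conjField hF _).hasFDerivAt
  have key : ∀ z, -(L (ζ, (-(2 * Complex.I)) • bil H z ζ)).2 =
      (2 * Complex.I) • (bil H (F (z, w)).1 ζ +
        bil H z (L (ζ, (-(2 * Complex.I)) • bil H z ζ)).1) := fun z => by
    set v : Amb n k := (ζ, (-(2 * Complex.I)) • bil H z ζ) with hv
    have hline : HasDerivAt (fun ε : ℂ => ((0, w) : Amb n k) + ε • v) v 0 := by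
      simpa using ((hasDerivAt_id (0 : ℂ)).smul_const v).const_add ((0, w) : Amb n k)
    have hC : HasDerivAt (fun ε : ℂ => conjField F (((0, w) : Amb n k) + ε • v)) (L v) 0 :=
      HasFDerivAt.comp_hasDerivAt (l := conjField F) (l' := L) (0 : ℂ) (by simpa using hLd) hline
    have hl : HasDerivAt (fun ε : ℂ => (F (z, w)).2 - (conjField F (((0, w) : Amb n k) + ε • v)).2)
        (-(L v).2) 0 :=
      (((ContinuousLinearMap.snd ℂ (Fin n → ℂ) (Fin k → ℂ)).hasFDerivAt.comp_hasDerivAt 0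
        hC).const_sub _)
    have hr1 : HasDerivAt (fun ε : ℂ => bil H z (conjField F (((0, w) : Amb n k) + ε • v)).1)
        (bil H z (L v).1) 0 :=
      ((LinearMap.toContinuousLinearMap (bil H z)).hasFDerivAt.comp_hasDerivAt 0
        ((ContinuousLinearMap.fst ℂ (Fin n → ℂ) (Fin k → ℂ)).hasFDerivAt.comp_hasDerivAt 0 hC))
    have hr2 : HasDerivAt (fun ε : ℂ => ε • bil H (F (z, w)).1 ζ) (bil H (F (z, w)).1 ζ) 0 := by
      simpa using (hasDerivAt_id (0 : ℂ)).smul_const (bil H (F (z, w)).1 ζ)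
    refine hl.unique (((hr2.add hr1).const_smul (2 * Complex.I)).congr_of_eventuallyEq
      (Eventually.of_forall fun ε => ?_))
    have := complexified hH hF hT z (ε • ζ) w (w + ε • (-(2 * Complex.I)) • bil H z ζ) (by
      rw [map_smul, smul_comm ε, neg_smul]
      abel)
    have e : ((0, w) : Amb n k) + ε • v =
        (ε • ζ, w + ε • (-(2 * Complex.I)) • bil H z ζ) := by
      rw [hv, Prod.smul_mk, Prod.mk_add_mk, zero_add]
    rw [← e, map_smul] at this
    exact this
  set L₁ : (Fin k → ℂ) →ₗ[ℂ] Amb n k := L.toLinearMap ∘ₗ LinearMap.inr ℂ _ _ with hL₁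
  have hsplit : ∀ z, L (ζ, (-(2 * Complex.I)) • bil H z ζ) =
      L (ζ, 0) + (-(2 * Complex.I)) • L₁ (bil H z ζ) := fun z => by
    have : (ζ, (-(2 * Complex.I)) • bil H z ζ) =
        ((ζ, 0) : Amb n k) + (-(2 * Complex.I)) • ((0, bil H z ζ) : Amb n k) := by simp
    rw [this, map_add, map_smul]
    rfl
  refine ⟨(-(1 / (2 * Complex.I))) • (L (ζ, 0)).2,
    LinearMap.snd ℂ _ _ ∘ₗ L₁ ∘ₗ (bil H).flip ζ - (bil H).flip (L (ζ, 0)).1,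
    (2 * Complex.I) • (bil H).compl₂ (LinearMap.fst ℂ _ _ ∘ₗ L₁ ∘ₗ (bil H).flip ζ),
    fun z => ?_⟩
  have hk := key z
  rw [hsplit] at hk
  ext j
  have hj := congrFun hk j
  simp only [Prod.snd_add, Prod.fst_add, Prod.smul_snd, Prod.smul_fst, map_add, map_smul,
    Pi.add_apply, Pi.neg_apply, Pi.smul_apply, smul_eq_mul] at hj
  simp only [Pi.add_apply, Pi.smul_apply, smul_eq_mul, LinearMap.sub_apply, LinearMap.comp_apply,
    LinearMap.flip_apply, LinearMap.smul_apply, LinearMap.compl₂_apply, Pi.sub_apply,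
    LinearMap.fst_apply, LinearMap.snd_apply]
  have hI : Complex.I ≠ 0 := Complex.I_ne_zero
  field_simp
  linear_combination -hj

/-- The first component of a tangent field is at most quadratic in `z`. -/
lemma fst_smul_eq (hH : Nondegenerate H)
    (hF : Differentiable ℂ F) (hT : IsTangent H F) (z : Fin n → ℂ) (w : Fin k → ℂ) (s : ℂ) :
    (F (s • z, w)).1 = (1 + (-3 / 2) * s + (1 / 2) * s ^ 2) • (F (0, w)).1 +
      (0 + 2 * s + (-1) * s ^ 2) • (F (z, w)).1 +
      (0 + (-1 / 2) * s + (1 / 2) * s ^ 2) • (F ((2 : ℂ) • z, w)).1 := by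
  refine eq_of_bil_left hH fun ζ => ?_
  obtain ⟨A₀, A₁, A₂, hA⟩ := exists_bil_fst_eq hH.hermitian hF hT w ζ
  simp only [map_add, map_smul, LinearMap.add_apply, LinearMap.smul_apply, hA, map_zero]
  ext j
  simp only [Pi.add_apply, Pi.smul_apply, smul_eq_mul, Pi.zero_apply]
  ring

lemma fst_add_smul_of_odd (hH : Nondegenerate H)
    (hF : Differentiable ℂ F) (hT : IsTangent H F) (w : Fin k → ℂ)
    (hodd : ∀ z, (F (-z, w)).1 = -(F (z, w)).1) (z z' : Fin n → ℂ) (t : ℂ) :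
    (F (z + t • z', w)).1 = (F (z, w)).1 + t • (F (z', w)).1 := by
  refine eq_of_bil_left hH fun ζ => ?_
  obtain ⟨A₀, A₁, A₂, hA⟩ := exists_bil_fst_eq hH.hermitian hF hT w ζ
  have hlin : ∀ z, bil H (F (z, w)).1 ζ = A₁ z := fun z => by
    have h1 := hA (-z)
    rw [hodd, map_neg, LinearMap.neg_apply, hA z] at h1
    simp only [map_neg, LinearMap.neg_apply, neg_neg] at h1
    rw [hA]
    ext j
    have hj := congrFun h1 j
    simp only [Pi.add_apply, Pi.neg_apply] at hj ⊢
    linear_combination -(1 / 2 : ℂ) * hj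
  simp [hlin]

lemma fst_smul_of_even (hH : Nondegenerate H)
    (hF : Differentiable ℂ F) (hT : IsTangent H F) (w : Fin k → ℂ)
    (heven : ∀ z, (F (-z, w)).1 = (F (z, w)).1) (z : Fin n → ℂ) (s : ℂ) :
    (F (s • z, w)).1 = (F (0, w)).1 + s ^ 2 • ((F (z, w)).1 - (F (0, w)).1) := by
  refine eq_of_bil_left hH fun ζ => ?_
  obtain ⟨A₀, A₁, A₂, hA⟩ := exists_bil_fst_eq hH.hermitian hF hT w ζ
  have hquad : ∀ z, A₁ z = 0 := fun z => by
    have h1 := hA (-z)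
    rw [heven, hA z] at h1
    simp only [map_neg, LinearMap.neg_apply, neg_neg] at h1
    ext j
    have hj := congrFun h1 j
    simp only [Pi.add_apply, Pi.neg_apply, Pi.zero_apply] at hj ⊢
    linear_combination (1 / 2 : ℂ) * hj
  simp only [map_add, map_sub, map_smul, LinearMap.add_apply, LinearMap.smul_apply,
    LinearMap.sub_apply, hA, map_zero, hquad]
  ext j
  simp only [Pi.add_apply, Pi.smul_apply, Pi.sub_apply, smul_eq_mul, Pi.zero_apply]
  ring

end Structure

/-! ### Two functional equations -/

section FunctionalEquations

/-- Exchanging τ and τ' shows that d is constant. -/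
lemma exists_affine_of_sub_eq {a d : ℂ → ℂ} (h : ∀ τ τ', a τ - a τ' = (τ - τ') * d τ) :
    ∃ b c : ℂ, ∀ τ, a τ = b + c * τ := by
  have hd : ∀ τ, τ ≠ 0 → d τ = d 0 := fun τ hτ => by
    have h1 := h τ 0
    have h2 := h 0 τ
    exact mul_left_cancel₀ hτ (by linear_combination -h1 - h2)
  refine ⟨a 0, d 0, fun τ => ?_⟩
  have h2 := h 0 τ
  linear_combination -h2

/-- Exchanging τ and τ' shows that Φ − Ψ is constant; adding the differences between τ, 0 and 1 then
makes Φ affine. -/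
lemma exists_quadratic_of_sub_eq {G Φ Ψ : ℂ → ℂ}
    (h : ∀ τ τ', G τ - G τ' = (τ - τ') * (Φ τ + Ψ τ')) :
    ∃ a b c : ℂ, ∀ τ, G τ = a + b * τ + c * τ ^ 2 := by
  refine ⟨G 0, Ψ 0 + Φ 0, Φ 1 - Φ 0, fun τ => ?_⟩
  rcases eq_or_ne τ 0 with rfl | hτ
  · ring
  rcases eq_or_ne τ 1 with rfl | hτ1
  · linear_combination h 1 0
  have hs : ∀ τ τ', τ ≠ τ' → Φ τ + Ψ τ' = Φ τ' + Ψ τ := fun τ τ' hne =>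
    mul_left_cancel₀ (sub_ne_zero.mpr hne) (by linear_combination -(h τ τ') - h τ' τ)
  have h1 := h τ 0
  have h2 := h τ 1
  have h3 := h 1 0
  have h4 := hs 1 0 one_ne_zero
  have e : Φ τ - Φ 0 = τ * (Φ 1 - Φ 0) := by
    linear_combination -h1 + h2 + h3 - (τ - 1) * h4
  linear_combination h1 + τ * e

end FunctionalEquations

/-- Differentiate the constancy of Φ(ζ+εd) along γ(ζ+εd) at ε = 0: Φ_d(x+τγζ) + τ ∂_{γd}Φ_ζ(x+τγζ) =
Φ_d(x). The derivative does not depend on τ, since Φ_ζ is constant along γζ. -/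
lemma affineAlong_of_constant {B V : Type*} [AddCommGroup B] [Module ℂ B] [NormedAddCommGroup V]
    [NormedSpace ℂ V] (γ : B →ₗ[ℂ] V) (Φ : B →ₗ[ℂ] V → ℂ) (hd : ∀ ζ, Differentiable ℂ (Φ ζ))
    (hc : ∀ ζ x (τ : ℂ), Φ ζ (x + τ • γ ζ) = Φ ζ x) (d ζ : B) :
    AffineAlong (Φ d) (γ ζ) := by
  intro x
  refine ⟨Φ d x, -fderiv ℂ (Φ ζ) x (γ d), fun τ => ?_⟩
  have hD : fderiv ℂ (Φ ζ) (x + τ • γ ζ) (γ d) = fderiv ℂ (Φ ζ) x (γ d) := by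
    refine (hasDerivAt_line (hd ζ) (x + τ • γ ζ) (γ d)).unique ?_
    refine (hasDerivAt_line (hd ζ) x (γ d)).congr_of_eventuallyEq
      (Eventually.of_forall fun ε => ?_)
    have := hc ζ (x + ε • γ d) τ
    rw [add_right_comm] at this
    exact this
  have h1 : HasDerivAt (fun ε : ℂ => ε * Φ d (x + τ • γ ζ + ε • τ • γ d))
      (Φ d (x + τ • γ ζ)) 0 :=
    ((hasDerivAt_id (0 : ℂ)).mul
      (hasDerivAt_line (hd d) (x + τ • γ ζ) (τ • γ d))).congr_deriv (by simp)
  have h2 : HasDerivAt (fun ε : ℂ => Φ ζ x + ε * Φ d x) (Φ d x) 0 := by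
    simpa using ((hasDerivAt_id (0 : ℂ)).mul_const (Φ d x)).const_add (Φ ζ x)
  have key : fderiv ℂ (Φ ζ) (x + τ • γ ζ) (τ • γ d) + Φ d (x + τ • γ ζ) = Φ d x := by
    refine ((hasDerivAt_line (hd ζ) (x + τ • γ ζ) (τ • γ d)).add h1).unique ?_
    refine h2.congr_of_eventuallyEq (Eventually.of_forall fun ε => ?_)
    have := hc (ζ + ε • d) x τ
    simp only [map_add, map_smul, Pi.add_apply, Pi.smul_apply, smul_eq_mul] at this
    rw [smul_add, smul_comm τ ε, ← add_assoc] at this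
    exact this
  rw [map_smul, smul_eq_mul, hD] at key
  linear_combination key

/-! ### Vanishing of tangent fields of large weight -/

section Weight

variable {n k : ℕ} {H : Fin k → Matrix (Fin n) (Fin n) ℂ} {F : Amb n k → Amb n k}

/-- The components of the field are quasi-homogeneous of the weights `M` and `M + 1`. -/
def IsQuasiHomogeneous (F : Amb n k → Amb n k) (M : ℕ) : Prop :=
  ∀ (t : ℂ) (z : Fin n → ℂ) (w : Fin k → ℂ),
    (F (t • z, t ^ 2 • w)).1 = t ^ M • (F (z, w)).1 ∧
    (F (t • z, t ^ 2 • w)).2 = t ^ (M + 1) • (F (z, w)).2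

lemma IsQuasiHomogeneous.conjField {M : ℕ} (hF : IsQuasiHomogeneous F M) :
    IsQuasiHomogeneous (conjField F) M := by
  intro t z w
  have := hF (star t) (star z) (star w)
  have e : star ((t • z, t ^ 2 • w) : Amb n k) = (star t • star z, star t ^ 2 • star w) := by
    rw [Prod.star_def, star_smul, star_smul, star_pow]
  have e' : star ((z, w) : Amb n k) = (star z, star w) := rfl
  constructor
  · rw [CRQuadric.conjField, e, Prod.fst_star, this.1, star_smul, star_pow, star_star,
      CRQuadric.conjField, e', Prod.fst_star]
  · rw [CRQuadric.conjField, e, Prod.snd_star, this.2, star_smul, star_pow, star_star,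
      CRQuadric.conjField, e', Prod.snd_star]

lemma IsQuasiHomogeneous.neg_left {M : ℕ} (hF : IsQuasiHomogeneous F M)
    (z : Fin n → ℂ) (w : Fin k → ℂ) :
    (F (-z, w)).1 = (-1 : ℂ) ^ M • (F (z, w)).1 ∧ (F (-z, w)).2 = (-1 : ℂ) ^ (M + 1) • (F (z, w)).2 := by
  simpa using hF (-1) z w

lemma exists_sq_eq (τ : ℂ) : ∃ t : ℂ, t ^ 2 = τ := IsAlgClosed.exists_pow_nat_eq τ two_pos

lemma linear_of_odd_weight (hH : Nondegenerate H)
    (hF : Differentiable ℂ F) (hT : IsTangent H F) {M : ℕ} (hM : Odd M)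
    (hq : IsQuasiHomogeneous F M) (z z' : Fin n → ℂ) (w : Fin k → ℂ) (t : ℂ) :
    (F (z + t • z', w)).1 = (F (z, w)).1 + t • (F (z', w)).1 :=
  fst_add_smul_of_odd hH hF hT w (fun z => by
    rw [(hq.neg_left z w).1, hM.neg_one_pow, neg_one_smul]) z z' t

/-- By parity f is linear in z and g does not depend on z. The functional equation makes g quadratic
along values of β, which kills g. What remains says that β(f(z,·),ζ) is constant along β(z,ζ), and
polarization in ζ gives the affinity needed to kill f. -/
lemma eq_zero_of_odd_weight (hk : 0 < k) (hH : Nondegenerate H)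
    (hF : Differentiable ℂ F) (hT : IsTangent H F) {D : ℕ} (hD : k < D)
    (hq : IsQuasiHomogeneous F (2 * D + 1)) : F = 0 := by
  have hodd : Odd (2 * D + 1) := odd_two_mul_add_one D
  have hlin := fun z z' w t => linear_of_odd_weight hH hF hT hodd hq z z' w t
  have hf0 : ∀ w, (F (0, w)).1 = 0 := fun w => by
    have := (hq.neg_left 0 w).1
    rw [neg_zero, hodd.neg_one_pow, neg_one_smul] at this
    exact self_eq_neg.mp this
  have hfs : ∀ z w (t : ℂ), (F (t • z, w)).1 = t • (F (z, w)).1 := fun z w t => by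
    have := hlin 0 z w t
    rwa [zero_add, hf0, zero_add] at this
  have hcs : ∀ z w (t : ℂ), (conjField F (t • z, w)).1 = t • (conjField F (z, w)).1 :=
    fun z w t => by
      have := hfs (star z) (star w) (star t)
      have e : star ((t • z, w) : Amb n k) = (star t • star z, star w) := by
        rw [Prod.star_def, star_smul]
      have e' : star ((z, w) : Amb n k) = (star z, star w) := rfl
      rw [conjField, conjField, e, e', Prod.fst_star, this, star_smul, star_star, Prod.fst_star]
  have hc0 : ∀ w, (conjField F (0, w)).1 = 0 := fun w => by
    have := hcs 0 w 0
    rwa [zero_smul, zero_smul] at this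
  have hg : ∀ z w, (F (z, w)).2 = (F (0, w)).2 := fun z w => by
    rw [snd_eq hH.hermitian hF hT, hc0, map_zero, smul_zero, add_zero]
  have hgc : ∀ z w, (conjField F (z, w)).2 = (F (0, w)).2 := fun z w => by
    have := congrArg star (hg (star z) (star w))
    have e' : star ((0, w) : Amb n k) = (0, star w) := by rw [Prod.star_def, star_zero]
    have h2 := conjField_snd_zero hH.hermitian hF hT w
    rw [← h2, conjField, conjField, e', Prod.snd_star, Prod.snd_star, ← this]
    rfl
  -- The two points differ by (τ−τ')β(z,ζ), so ζ is rescaled by (τ−τ')/2i; linearity of f and f̄ in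
  -- their first arguments brings this factor out.
  have key : ∀ z ζ x (j : Fin k) (τ τ' : ℂ),
      (F (0, x + τ • bil H z ζ)).2 j - (F (0, x + τ' • bil H z ζ)).2 j =
        (τ - τ') * (bil H (F (z, x + τ • bil H z ζ)).1 ζ j +
          bil H z (conjField F (ζ, x + τ' • bil H z ζ)).1 j) := fun z ζ x j τ τ' => by
    have := complexified hH.hermitian hF hT z (((τ - τ') / (2 * Complex.I)) • ζ)
      (x + τ • bil H z ζ) (x + τ' • bil H z ζ) (by
        rw [map_smul, smul_smul, mul_div_cancel₀ _ (by simp), sub_smul]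
        abel)
    rw [hg, hgc, hcs, map_smul, map_smul, ← smul_add, smul_smul,
      mul_div_cancel₀ _ (by simp)] at this
    exact congrFun this j
  have hg0 : ∀ w, (F (0, w)).2 = 0 := fun w => by
    ext j
    obtain ⟨l, hl, hmem⟩ := exists_list_sum_sub_mem (bil H) (span_range_bil hH) ⊥ w
    have hw : (l.map fun p => bil H p.1 p.2).sum = w := by
      rw [Submodule.mem_bot, sub_eq_zero] at hmem
      exact hmem.symm
    have hfin := Submodule.finrank_quotient_add_finrank (⊥ : Submodule ℂ (Fin k → ℂ))
    rw [finrank_bot, add_zero, Module.finrank_fin_fun] at hfin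
    -- g has weight 2D+2, hence degree D+1 in w, while 2|l| ≤ k+1 < D+1.
    refine eq_zero_of_homogeneous_of_isPolyLE (h := fun w => (F (0, w)).2 j) (D := D + 1)
      (fun τ _ => ?_) (d := 2 * l.length) ?_ (by omega)
    · obtain ⟨t, rfl⟩ := exists_sq_eq τ
      have := congrFun (hq t 0 w).2 j
      rw [smul_zero] at this
      rw [this, ← pow_mul]
      rfl
    · have := isPolyLE_along_list_sum (l.map fun p => bil H p.1 p.2)
        (fun w => (F (0, w)).2 j) (fun v hv x => by
          obtain ⟨p, -, rfl⟩ := List.mem_map.mp hv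
          exact exists_quadratic_of_sub_eq (key p.1 p.2 x j)) 0
      simpa [hw] using this
  have hconst : ∀ z ζ x j (τ : ℂ),
      bil H (F (z, x + τ • bil H z ζ)).1 ζ j = bil H (F (z, x)).1 ζ j := fun z ζ x j τ => by
    have h0 : ∀ τ τ' : ℂ, τ ≠ τ' → bil H (F (z, x + τ • bil H z ζ)).1 ζ j =
        -bil H z (conjField F (ζ, x + τ' • bil H z ζ)).1 j := fun τ τ' hne => by
      have := key z ζ x j τ τ'
      rw [hg0, hg0, sub_self, zero_eq_mul] at this
      exact eq_neg_of_add_eq_zero_left (this.resolve_left (sub_ne_zero.mpr hne))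
    -- The values at τ and at 0 are both compared with a third parameter, since the relation only
    -- holds for distinct ones.
    obtain ⟨τ', hτ'⟩ := ({τ, 0} : Finset ℂ).exists_notMem
    simp only [Finset.mem_insert, Finset.mem_singleton, not_or] at hτ'
    have h1 := h0 0 τ' (Ne.symm hτ'.2)
    rw [zero_smul, add_zero] at h1
    rw [h0 τ τ' (Ne.symm hτ'.1), h1]
  have hdiff : ∀ (c d : Fin n → ℂ) (j : Fin k),
      Differentiable ℂ (fun w => bil H (F (c, w)).1 d j) := fun c d j => by
    have h1 : Differentiable ℂ (fun w => (F (c, w)).1) := by fun_prop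
    exact differentiable_pi.mp (differentiable_bil h1 (differentiable_const d)) j
  have hbil : ∀ d j c w, bil H (F (c, w)).1 d j = 0 := fun d j => by
    let Ψ : (Fin n → ℂ) →ₗ[ℂ] (Fin k → ℂ) → ℂ :=
      { toFun := fun c w => bil H (F (c, w)).1 d j
        map_add' := fun c c' => by
          ext w
          have := hlin c c' w 1
          rw [one_smul, one_smul] at this
          rw [this, map_add]
          rfl
        map_smul' := fun t c => by
          ext w
          rw [hfs, map_smul]
          rfl }
    have hΨ : Ψ = 0 := by
      refine eq_zero_of_affineAlong_of_homogeneous (bil H) (span_range_bil hH)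
        (by rwa [Module.finrank_fin_fun]) (exists_min_two_le_finrank_range_bil hH) Ψ
        (fun c => hdiff c d j) (fun c ζ => ?_) (D := D) (by rwa [Module.finrank_fin_fun])
        (fun c v τ hτ => ?_)
      · let Φ : (Fin n → ℂ) →ₗ[ℂ] (Fin k → ℂ) → ℂ :=
          { toFun := fun ζ w => bil H (F (c, w)).1 ζ j
            map_add' := fun ζ ζ' => by ext w; simp
            map_smul' := fun t ζ => by ext w; simp }
        exact affineAlong_of_constant (bil H c) Φ (fun ζ => hdiff c ζ j)
          (fun ζ x τ => hconst c ζ x j τ) d ζ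
      · obtain ⟨t, rfl⟩ := exists_sq_eq τ
        have ht : t ≠ 0 := fun h => hτ (by rw [h]; ring)
        -- Linearity in c absorbs one factor t of t^(2D+1), leaving degree D in w.
        have := (hq t (t⁻¹ • c) v).1
        rw [smul_smul, mul_inv_cancel₀ ht, one_smul, hfs, smul_smul, pow_succ t (2 * D),
          mul_assoc, mul_inv_cancel₀ ht, mul_one, pow_mul] at this
        change bil H (F (c, t ^ 2 • v)).1 d j = (t ^ 2) ^ D * bil H (F (c, v)).1 d j
        rw [this, map_smul]
        rfl
    exact fun c w => congrFun (LinearMap.congr_fun hΨ c) w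
  refine funext fun p => Prod.ext ?_ ?_
  · exact eq_zero_of_bil_left hH fun ζ => funext fun j => hbil ζ j p.1 p.2
  · exact (hg p.1 p.2).trans (hg0 p.2)

/-- By parity g(0,w) = 0 and f is even in z, so g is determined by f̄(0,w). The functions
β(c,f̄(0,·)) are affine along β(c,ζ) and hence vanish; the same identity then kills the rest of f.
-/
lemma eq_zero_of_even_weight (hk : 0 < k) (hH : Nondegenerate H)
    (hF : Differentiable ℂ F) (hT : IsTangent H F) {D : ℕ} (hD : k < D)
    (hq : IsQuasiHomogeneous F (2 * D)) : F = 0 := by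
  have heven : Even (2 * D) := even_two_mul D
  have hsq : ∀ z w (s : ℂ), (F (s • z, w)).1 =
      (F (0, w)).1 + s ^ 2 • ((F (z, w)).1 - (F (0, w)).1) := fun z w s =>
    fst_smul_of_even hH hF hT w (fun z => by
      rw [(hq.neg_left z w).1, heven.neg_one_pow, one_smul]) z s
  have hcsq : ∀ z w (s : ℂ), (conjField F (s • z, w)).1 = (conjField F (0, w)).1 +
      s ^ 2 • ((conjField F (z, w)).1 - (conjField F (0, w)).1) := fun z w s => by
    have := hsq (star z) (star w) (star s)
    have e : star ((s • z, w) : Amb n k) = (star s • star z, star w) := by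
      rw [Prod.star_def, star_smul]
    have e' : star ((z, w) : Amb n k) = (star z, star w) := rfl
    have e0 : star ((0, w) : Amb n k) = (0, star w) := by rw [Prod.star_def, star_zero]
    rw [conjField, conjField, conjField, e, e', e0, Prod.fst_star, Prod.fst_star, Prod.fst_star,
      this, star_add, star_smul, star_sub, star_pow, star_star]
  have hg0 : ∀ w, (F (0, w)).2 = 0 := fun w => by
    have := (hq.neg_left 0 w).2
    rw [neg_zero, heven.add_one.neg_one_pow, neg_one_smul] at this
    exact self_eq_neg.mp this
  have hg : ∀ z w, (F (z, w)).2 = (2 * Complex.I) • bil H z (conjField F (0, w)).1 :=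
    fun z w => by rw [snd_eq hH.hermitian hF hT, hg0, zero_add]
  have hgc : ∀ ζ w, (conjField F (ζ, w)).2 = -((2 * Complex.I) • bil H (F (0, w)).1 ζ) :=
    fun ζ w => by
      have := complexified hH.hermitian hF hT 0 ζ w w (by simp)
      rw [hg0, zero_sub, map_zero, LinearMap.zero_apply, add_zero] at this
      rw [← this, neg_neg]
  have key : ∀ z ζ x (j : Fin k) (σ : ℂ),
      bil H z (conjField F (0, x)).1 j -
        bil H z (conjField F (0, x - (2 * Complex.I * σ) • bil H z ζ)).1 j =
      σ * bil H ((F (z, x)).1 - (F (0, x)).1) ζ j := fun z ζ x j σ => by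
    -- Replacing (z,ζ) by (sz,(σ/s)ζ) keeps β(z,ζ) scaled by σ alone, so w and w' are fixed and only
    -- the powers s and 1/s vary.
    have hs : ∀ s : ℂ, s ≠ 0 →
        s * (bil H z (conjField F (0, x)).1 j -
          bil H z (conjField F (0, x - (2 * Complex.I * σ) • bil H z ζ)).1 j) -
        s * (σ / s) ^ 2 * bil H z ((conjField F (ζ, x - (2 * Complex.I * σ) • bil H z ζ)).1 -
          (conjField F (0, x - (2 * Complex.I * σ) • bil H z ζ)).1) j =
        σ / s * (bil H (F (0, x)).1 ζ j -
          bil H (F (0, x - (2 * Complex.I * σ) • bil H z ζ)).1 ζ j) +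
        σ / s * s ^ 2 * bil H ((F (z, x)).1 - (F (0, x)).1) ζ j := fun s hs => by
      have h1 := complexified hH.hermitian hF hT (s • z) ((σ / s) • ζ) x
        (x - (2 * Complex.I * σ) • bil H z ζ) (by
          rw [map_smul, map_smul, LinearMap.smul_apply, sub_sub_cancel, smul_smul, smul_smul]
          congr 1
          field_simp)
      rw [hg, hgc, hsq, hcsq] at h1
      have hj := congrFun h1 j
      simp only [map_smul, map_add, LinearMap.smul_apply, LinearMap.add_apply, Pi.add_apply,
        Pi.sub_apply, Pi.neg_apply, Pi.smul_apply, smul_eq_mul] at hj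
      refine mul_left_cancel₀ (mul_ne_zero two_ne_zero Complex.I_ne_zero) ?_
      linear_combination hj
    have h1 := hs 1 one_ne_zero
    have h2 := hs 2 two_ne_zero
    -- The values s = 1 and s = 2 suffice to eliminate the 1/s terms and isolate the coefficient of
    -- s.
    linear_combination (2 / 3 : ℂ) * h2 - (1 / 3 : ℂ) * h1
  have hf0 : ∀ w, (conjField F (0, w)).1 = 0 := fun w => by
    refine eq_zero_of_bil_right hH fun c => funext fun j => ?_
    let Ψ : (Fin n → ℂ) →ₗ[ℂ] (Fin k → ℂ) → ℂ :=
      { toFun := fun c w => bil H c (conjField F (0, w)).1 j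
        map_add' := fun c c' => by ext w; simp
        map_smul' := fun t c => by ext w; simp }
    have hΨ : Ψ = 0 := by
      refine eq_zero_of_affineAlong_of_homogeneous (bil H) (span_range_bil hH)
        (by rwa [Module.finrank_fin_fun]) (exists_min_two_le_finrank_range_bil hH) Ψ
        (fun c => ?_) (fun c ζ x => ?_) (D := D) (by rwa [Module.finrank_fin_fun])
        (fun c v τ _ => ?_)
      · have hc := differentiable_conjField hF
        have h1 : Differentiable ℂ (fun w : Fin k → ℂ => ((0, w) : Amb n k)) := by fun_prop
        exact differentiable_pi.mp
          (differentiable_bil (H := H) (differentiable_const c) (hc.comp h1).fst) j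
      · refine exists_affine_of_sub_eq (d := fun τ => (1 / (2 * Complex.I)) *
          bil H ((F (c, x + τ • bil H c ζ)).1 - (F (0, x + τ • bil H c ζ)).1) ζ j)
          fun τ τ' => ?_
        -- With σ = (τ−τ')/2i the second point becomes x + τ'β(c,ζ).
        have := key c ζ (x + τ • bil H c ζ) j ((τ - τ') / (2 * Complex.I))
        have hI : (2 * Complex.I) ≠ 0 := by simp
        rw [mul_div_cancel₀ _ hI, sub_smul, add_sub_assoc, sub_sub_cancel] at this
        change bil H c (conjField F (0, x + τ • bil H c ζ)).1 j -
          bil H c (conjField F (0, x + τ' • bil H c ζ)).1 j = _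
        rw [this]
        ring
      · obtain ⟨t, rfl⟩ := exists_sq_eq τ
        have := (hq.conjField t 0 v).1
        rw [smul_zero, pow_mul] at this
        change bil H c (conjField F (0, t ^ 2 • v)).1 j = _
        rw [this, map_smul]
        rfl
    exact congrFun (LinearMap.congr_fun hΨ c) w
  have hf0' : ∀ w, (F (0, w)).1 = 0 := fun w => by
    have := hf0 (star w)
    have e0 : star ((0, star w) : Amb n k) = (0, w) := by
      rw [Prod.star_def, star_zero, star_star]
    rw [conjField, e0, Prod.fst_star, star_eq_zero] at this
    exact this
  refine funext fun p => Prod.ext ?_ ?_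
  · refine eq_zero_of_bil_left hH fun ζ => funext fun j => ?_
    have := key p.1 ζ p.2 j 1
    rw [hf0, hf0, sub_self, hf0', sub_zero, one_mul] at this
    exact this.symm
  · have := hg p.1 p.2
    rw [hf0, map_zero, smul_zero] at this
    exact this

/-- A tangent field whose components have the weights `M` and `M + 1` vanishes for
`M ≥ 2k + 2`. -/
theorem eq_zero_of_weight (hk : 0 < k) (hH : Nondegenerate H)
    (hF : Differentiable ℂ F) (hT : IsTangent H F) {M : ℕ} (hM : 2 * k + 2 ≤ M)
    (hq : IsQuasiHomogeneous F M) : F = 0 := by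
  obtain ⟨D, rfl | rfl⟩ := Nat.even_or_odd' M
  · exact eq_zero_of_even_weight hk hH hF hT (by omega) hq
  · exact eq_zero_of_odd_weight hk hH hF hT (by omega) hq

end Weight

/-! ### Weighted homogeneous polynomials -/

section Polynomials

open MvPolynomial

lemma eval_scale {ι : Type*} [Fintype ι] (v : ι → ℕ) (P : MvPolynomial ι ℂ) (x : ι → ℂ) (s : ℂ) :
    eval (fun i => s ^ v i * x i) P =
      ∑ d ∈ P.support, (coeff d P * ∏ i, x i ^ d i) * s ^ (∑ i, v i * d i) := by
  rw [eval_eq']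
  refine Finset.sum_congr rfl fun d _ => ?_
  simp only [mul_pow, Finset.prod_mul_distrib, ← pow_mul, Finset.prod_pow_eq_pow_sum]
  ring

/-- The coefficient of s^N is the value at x of the weight-N part of P. If N > q it vanishes for all
x, so that part is the zero polynomial. -/
lemma weighted_degree_le_of_isPolyLE {ι : Type*} [Fintype ι] (v : ι → ℕ) (P : MvPolynomial ι ℂ)
    {q : ℕ} (h : ∀ x : ι → ℂ, IsPolyLE q (fun s => eval (fun i => s ^ v i * x i) P))
    {d : ι →₀ ℕ} (hd : d ∈ P.support) : ∑ i, v i * d i ≤ q := by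
  classical
  by_contra! hlt
  set N := ∑ i, v i * d i with hN
  set P' : MvPolynomial ι ℂ :=
    ∑ e ∈ P.support with ∑ i, v i * e i = N, monomial e (coeff e P) with hP'
  have hzero : P' = 0 := by
    refine MvPolynomial.funext fun x => ?_
    obtain ⟨p, hp, hp'⟩ := h x
    have hpe : p = ∑ e ∈ P.support,
        Polynomial.C (coeff e P * ∏ i, x i ^ e i) * Polynomial.X ^ (∑ i, v i * e i) := by
      refine Polynomial.funext fun s => ?_
      rw [← hp' s, Polynomial.eval_finsetSum]
      simp only [Polynomial.eval_mul, Polynomial.eval_C, Polynomial.eval_pow, Polynomial.eval_X]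
      exact eval_scale v P x s
    have hc := Polynomial.coeff_eq_zero_of_natDegree_lt (hp.trans_lt hlt)
    rw [hpe, Polynomial.finsetSum_coeff] at hc
    simp only [Polynomial.coeff_C_mul_X_pow, eq_comm (a := N)] at hc
    rw [map_zero, hP', map_sum, Finset.sum_filter]
    refine Eq.trans ?_ hc
    refine Finset.sum_congr rfl fun e _ => ?_
    split_ifs
    · rw [eval_monomial, Finsupp.prod_fintype _ _ (by simp)]
    · rfl
  have hcoeff : coeff d P' = coeff d P := by
    rw [hP', coeff_sum]
    simp only [coeff_monomial]
    rw [Finset.sum_ite_eq' _ d, if_pos (Finset.mem_filter.mpr ⟨hd, hN.symm⟩)]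
  rw [hzero, coeff_zero] at hcoeff
  exact mem_support_iff.mp hd hcoeff.symm

variable {n k : ℕ}

/-- The weights of the variables as natural numbers. -/
def natWt (n k : ℕ) : Fin n ⊕ Fin k → ℕ := Sum.elim (fun _ => 1) (fun _ => 2)

lemma weight_wt (d : Fin n ⊕ Fin k →₀ ℕ) :
    Finsupp.weight (wt n k) d = ((∑ a, d (.inl a) + 2 * ∑ j, d (.inr j) : ℕ) : ℤ) := by
  rw [Finsupp.weight_apply, Finsupp.sum_fintype _ _ (by simp)]
  simp [wt, Fintype.sum_sum_type, Finset.mul_sum, mul_comm]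

lemma eval_smul_of_isWeightedHomogeneous {P : Poly n k} {M : ℕ}
    (hP : P.IsWeightedHomogeneous (wt n k) (M : ℤ)) (t : ℂ) (z : Fin n → ℂ) (w : Fin k → ℂ) :
    eval (Sum.elim (t • z) (t ^ 2 • w)) P = t ^ M * eval (Sum.elim z w) P := by
  have e : Sum.elim (t • z) (t ^ 2 • w) = fun i => t ^ natWt n k i * (Sum.elim z w i : ℂ) := by
    ext i; rcases i with a | j <;> simp [natWt]
  rw [e, eval_scale, eval_eq', Finset.mul_sum]
  refine Finset.sum_congr rfl fun d hd => ?_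
  have := hP (mem_support_iff.mp hd)
  rw [weight_wt, Nat.cast_inj] at this
  have h2 : ∑ i, natWt n k i * d i = M := by
    rw [← this, Fintype.sum_sum_type, Finset.mul_sum]
    simp [natWt]
  rw [h2]
  ring

/-- A polynomial of weight `M` and of degree at most `q` in `z` has degree at most
`(M + q) / 2`. -/
lemma totalDegree_le_of_isPolyLE {P : Poly n k} {M q B : ℕ}
    (hP : P.IsWeightedHomogeneous (wt n k) (M : ℤ))
    (hq : ∀ (z : Fin n → ℂ) (w : Fin k → ℂ),
      IsPolyLE q (fun s => eval (Sum.elim (s • z) w) P))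
    (hB : M + q ≤ 2 * B + 1) : P.totalDegree ≤ B := by
  refine Finset.sup_le fun d hd => ?_
  have h1 := weighted_degree_le_of_isPolyLE (Sum.elim (fun _ => 1) (fun _ => 0)) P (q := q)
    (fun x => by
      convert hq (fun a => x (.inl a)) (fun j => x (.inr j)) using 4 with s
      ext i
      rcases i with a | j <;> simp) hd
  have h2 := hP (mem_support_iff.mp hd)
  rw [weight_wt, Nat.cast_inj] at h2
  rw [Finsupp.sum_fintype _ _ (by simp), Fintype.sum_sum_type]
  simp only [Fintype.sum_sum_type, Sum.elim_inl, Sum.elim_inr, one_mul, zero_mul,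
    Finset.sum_const_zero, add_zero] at h1
  omega

lemma totalDegree_aeval_le {ι κ : Type*} (φ : ι → MvPolynomial κ ℂ)
    (hφ : ∀ i, (φ i).totalDegree ≤ 1) (P : MvPolynomial ι ℂ) :
    (aeval φ P).totalDegree ≤ P.totalDegree := by
  rw [aeval_def, eval₂_eq]
  refine totalDegree_finsetSum_le fun d hd => ?_
  refine (totalDegree_mul _ _).trans ?_
  rw [algebraMap_eq, totalDegree_C, zero_add]
  refine (totalDegree_finsetProd _ _).trans ?_
  refine le_trans (Finset.sum_le_sum fun i _ => ?_) (le_totalDegree hd)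
  exact (totalDegree_pow _ _).trans ((Nat.mul_le_mul_left _ (hφ i)).trans_eq (mul_one _))

lemma analyticAt_polyField (P : Fin n → Poly n k) (R : Fin k → Poly n k) (p : Amb n k) :
    AnalyticAt ℂ (polyField P R) p := by
  have h : ∀ Q : Poly n k, AnalyticAt ℂ (fun p : Amb n k => eval (Sum.elim p.1 p.2) Q) p :=
    fun Q => by
      refine AnalyticAt.aeval_mvPolynomial (f := fun p : Amb n k => Sum.elim p.1 p.2)
        (fun i => ?_) Q
      rcases i with a | j
      · exact ((ContinuousLinearMap.proj (R := ℂ) (φ := fun _ : Fin n => ℂ) a).comp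
          (ContinuousLinearMap.fst ℂ _ _)).analyticAt p
      · exact ((ContinuousLinearMap.proj (R := ℂ) (φ := fun _ : Fin k => ℂ) j).comp
          (ContinuousLinearMap.snd ℂ _ _)).analyticAt p
  exact (analyticAt_pi_iff.mpr fun a => h (P a)).prod (analyticAt_pi_iff.mpr fun j => h (R j))

lemma differentiable_polyField (P : Fin n → Poly n k) (R : Fin k → Poly n k) :
    Differentiable ℂ (polyField P R) := fun p => (analyticAt_polyField P R p).differentiableAt

lemma eq_zero_of_eventually_eval_eq_zero {Q : Poly n k}
    (h : ∀ᶠ p : Amb n k in 𝓝 0, eval (Sum.elim p.1 p.2) Q = 0) : Q = 0 := by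
  obtain ⟨ε, hε, hball⟩ := Metric.eventually_nhds_iff.mp h
  refine funext_set (fun _ => Metric.ball (0 : ℂ) ε) (fun _ => ?_) fun x hx => ?_
  · exact infinite_of_mem_nhds 0 (Metric.ball_mem_nhds 0 hε)
  · have := @hball ((fun a => x (.inl a), fun j => x (.inr j))) (by
      have hx' : ∀ i, dist (x i) 0 < ε := fun i => hx i trivial
      rw [Prod.dist_eq, max_lt_iff, dist_pi_lt_iff hε, dist_pi_lt_iff hε]
      exact ⟨fun a => hx' _, fun j => hx' _⟩)
    rw [map_zero, ← this]
    congr 2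
    ext i
    rcases i with a | j <;> rfl

end Polynomials

/-! ### Expansion of analytic functions in weighted homogeneous polynomials -/

section Expansion

open MvPolynomial

variable {n k : ℕ}

lemma one_le_natWt (i : Fin n ⊕ Fin k) : 1 ≤ natWt n k i := by
  rcases i with a | j <;> simp [natWt]

/-- Words in the variables. -/
abbrev Word (n k : ℕ) : Type := Σ N : ℕ, Fin N → Fin n ⊕ Fin k

/-- The weight of a word. -/
def wordWt (y : Word n k) : ℕ := ∑ i, natWt n k (y.2 i)

lemma finite_wordWt_fiber (M : ℕ) : Finite {y : Word n k // wordWt y = M} := by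
  have hle : ∀ y : {y : Word n k // wordWt y = M}, y.1.1 < M + 1 := fun y => by
    have : ∑ _i : Fin y.1.1, 1 ≤ wordWt y.1 := Finset.sum_le_sum fun i _ => one_le_natWt _
    rw [y.2] at this
    simp only [Finset.sum_const, Finset.card_univ, Fintype.card_fin, smul_eq_mul, mul_one] at this
    omega
  let g : {y : Word n k // wordWt y = M} → Σ N : Fin (M + 1), Fin N → Fin n ⊕ Fin k :=
    fun y => ⟨⟨y.1.1, hle y⟩, y.1.2⟩
  refine Finite.of_injective g fun y y' h => ?_
  obtain ⟨⟨N, σ⟩, hy⟩ := y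
  obtain ⟨⟨N', σ'⟩, hy'⟩ := y'
  simp only [g, Sigma.mk.injEq, Fin.mk.injEq] at h
  obtain ⟨rfl, h⟩ := h
  cases h
  rfl

/-- The coordinate vectors of `ℂⁿ × ℂᵏ`. -/
def basisVec (n k : ℕ) : Fin n ⊕ Fin k → Amb n k :=
  Sum.elim (fun a => (Pi.single a 1, 0)) (fun j => (0, Pi.single j 1))

lemma norm_basisVec_le (i : Fin n ⊕ Fin k) : ‖basisVec n k i‖ ≤ 1 := by
  have h : ∀ {m : ℕ} (a : Fin m), ‖(Pi.single a 1 : Fin m → ℂ)‖ ≤ 1 := fun a =>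
    (pi_norm_le_iff_of_nonneg zero_le_one).mpr fun b => by
      rcases eq_or_ne b a with rfl | hb
      · simp
      · simp [hb]
  rcases i with a | j <;> simpa [basisVec, Prod.norm_def] using h _

lemma sum_smul_basisVec (p : Amb n k) :
    ∑ i, (Sum.elim p.1 p.2 i : ℂ) • basisVec n k i = p := by
  rw [Fintype.sum_sum_type]
  ext i <;> simp [basisVec, Prod.fst_sum, Prod.snd_sum, Finset.sum_apply, Pi.single_apply]

/-- Expand each multilinear term over words in the coordinates and regroup the sum by weight. A
given weight occurs for finitely many words because every letter has weight at least 1; regrouping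
is justified by absolute summability near 0. -/
theorem exists_weighted_expansion {h : Amb n k → ℂ} (hh : AnalyticAt ℂ h 0) :
    ∃ P : ℕ → Poly n k, (∀ M, (P M).IsWeightedHomogeneous (wt n k) (M : ℤ)) ∧
      ∀ᶠ p in 𝓝 0, HasSum (fun M => eval (Sum.elim p.1 p.2) (P M)) (h p) := by
  classical
  obtain ⟨q, r, hq⟩ := hh
  set c : Word n k → ℂ := fun y => q y.1 fun i => basisVec n k (y.2 i) with hc
  have : ∀ M, Fintype {y : Word n k // wordWt y = M} := fun M =>
    @Fintype.ofFinite _ (finite_wordWt_fiber M)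
  refine ⟨fun M => ∑ y : {y : Word n k // wordWt y = M}, C (c y.1) * ∏ i, X (y.1.2 i),
    fun M => ?_, ?_⟩
  · refine IsWeightedHomogeneous.sum _ _ _ fun y _ => IsWeightedHomogeneous.C_mul ?_ _
    have h1 := IsWeightedHomogeneous.prod (R := ℂ) (w := wt n k) Finset.univ
      (fun i => X (y.1.2 i)) (fun i => wt n k (y.1.2 i))
      (fun i _ => isWeightedHomogeneous_X _ _ _)
    convert h1 using 1
    refine (congrArg Nat.cast y.2.symm).trans ?_
    rw [wordWt, Nat.cast_sum]
    refine Finset.sum_congr rfl fun i _ => ?_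
    rcases y.1.2 i with a | j <;> rfl
  obtain ⟨r₁, hr₁, hr₁r⟩ : ∃ r₁ : NNReal, 0 < r₁ ∧ (r₁ : ENNReal) < r := by
    obtain ⟨r₁, h1, h2⟩ := ENNReal.lt_iff_exists_nnreal_btwn.mp hq.r_pos
    exact ⟨r₁, by exact_mod_cast h1, h2⟩
  set κ : ℝ := ((Fintype.card (Fin n ⊕ Fin k) : ℕ) : ℝ) with hκ
  have hκ0 : 0 ≤ κ := Nat.cast_nonneg _
  -- There are κ^N words of length N, so κρ ≤ r₁ bounds their total contribution by ‖q N‖ r₁^N.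
  set ρ : ℝ := r₁ / (κ + 1) with hρ
  have hρ0 : 0 < ρ := div_pos (by exact_mod_cast hr₁) (by positivity)
  have hκρ : κ * ρ ≤ r₁ := by
    rw [hρ, mul_div_assoc', div_le_iff₀ (by positivity)]
    nlinarith [r₁.2]
  have hρr : ρ ≤ r₁ := div_le_self r₁.2 (by linarith)
  filter_upwards [Metric.ball_mem_nhds (0 : Amb n k) hρ0] with p hp
  have hpn : ‖p‖ < ρ := by simpa using hp
  have hcoord : ∀ i, ‖(Sum.elim p.1 p.2 i : ℂ)‖ ≤ ρ := fun i => by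
    refine le_trans ?_ hpn.le
    rcases i with a | j
    · exact (norm_le_pi_norm p.1 a).trans (norm_fst_le p)
    · exact (norm_le_pi_norm p.2 j).trans (norm_snd_le p)
  set T : Word n k → ℂ := fun y => (∏ i, (Sum.elim p.1 p.2 (y.2 i) : ℂ)) * c y with hT
  have hTle : ∀ y, ‖T y‖ ≤ ρ ^ y.1 * ‖q y.1‖ := fun y => by
    rw [hT]
    simp only [norm_mul, norm_prod]
    refine mul_le_mul ?_ ?_ (norm_nonneg _) (pow_nonneg hρ0.le _)
    · calc ∏ i, ‖(Sum.elim p.1 p.2 (y.2 i) : ℂ)‖ ≤ ∏ _i : Fin y.1, ρ :=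
            Finset.prod_le_prod (fun i _ => norm_nonneg _) fun i _ => hcoord _
        _ = ρ ^ y.1 := by simp
    · refine ((q y.1).le_opNorm _).trans ?_
      refine mul_le_of_le_one_right (norm_nonneg _) ?_
      exact Finset.prod_le_one (fun i _ => norm_nonneg _) fun i _ => norm_basisVec_le _
  have hsum : Summable T := by
    refine Summable.of_norm_bounded (g := fun y : Word n k => ρ ^ y.1 * ‖q y.1‖) ?_ hTle
    rw [summable_sigma_of_nonneg (fun y => by positivity)]
    refine ⟨fun N => (hasSum_fintype _).summable, ?_⟩
    have hs := q.summable_norm_mul_pow (hr₁r.trans_le hq.r_le)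
    refine Summable.of_nonneg_of_le (fun N => tsum_nonneg fun _ => by positivity)
      (fun N => ?_) hs
    rw [tsum_fintype]
    change ∑ _b : Fin N → Fin n ⊕ Fin k, ρ ^ N * ‖q N‖ ≤ _
    rw [Finset.sum_const, Finset.card_univ, Fintype.card_fun, Fintype.card_fin,
      nsmul_eq_mul, Nat.cast_pow, ← mul_assoc, ← mul_pow, mul_comm]
    gcongr
  have hTh : HasSum T (h p) := by
    have h1 := hsum.hasSum.sigma fun N => hasSum_fintype fun σ : Fin N → Fin n ⊕ Fin k => T ⟨N, σ⟩
    have h2 := hq.hasSum (y := p) (by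
      rw [Metric.mem_eball, edist_zero_right, ← ofReal_norm]
      refine lt_of_le_of_lt ?_ hr₁r
      rw [← ENNReal.ofReal_coe_nnreal]
      exact ENNReal.ofReal_le_ofReal (hpn.le.trans hρr))
    rw [zero_add] at h2
    have e : ∀ N, (q N fun _ => p) = ∑ σ : Fin N → Fin n ⊕ Fin k, T ⟨N, σ⟩ := fun N => by
      conv_lhs => rw [← sum_smul_basisVec p]
      rw [ContinuousMultilinearMap.map_sum]
      refine Finset.sum_congr rfl fun σ _ => ?_
      rw [ContinuousMultilinearMap.map_smul_univ, smul_eq_mul]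
    simp only [e] at h2
    rw [← h1.unique h2]
    exact hsum.hasSum
  have h3 := ((Equiv.sigmaFiberEquiv (wordWt (n := n) (k := k))).hasSum_iff.mpr hTh).sigma
    fun M => hasSum_fintype _
  convert h3 using 2 with M
  rw [map_sum]
  refine Finset.sum_congr rfl fun y _ => ?_
  simp only [map_mul, eval_C, map_prod, eval_X, Function.comp_apply, Equiv.sigmaFiberEquiv, hT,
    Equiv.coe_fn_mk]
  rw [mul_comm]

end Expansion

/-! ### The differential of the defining function -/

section Tangency

variable {n k : ℕ} {H : Fin k → Matrix (Fin n) (Fin n) ℂ}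

lemma differentiable_defFun : Differentiable ℝ (defFun (n := n) (k := k) H) := by
  rw [differentiable_pi]
  intro j
  have h1 : Differentiable ℝ (fun p : Amb n k => (p.2 j).im) :=
    Complex.imCLM.differentiable.comp (by fun_prop)
  have hconj : ∀ b, Differentiable ℝ (fun p : Amb n k => (starRingEnd ℂ) (p.1 b)) := fun b =>
    Complex.conjCLE.differentiable.comp (by fun_prop)
  have h2 : Differentiable ℝ (fun p : Amb n k => (form H p.1 p.1 j).re) := by
    refine Complex.reCLM.differentiable.comp ?_
    simp only [form]
    refine Differentiable.fun_sum fun a _ => Differentiable.fun_sum fun b _ => ?_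
    exact Differentiable.mul (by fun_prop) (hconj b)
  exact h1.sub h2

lemma fderiv_defFun (hH : ∀ j, (H j).IsHermitian) (p v : Amb n k) (j : Fin k) :
    fderiv ℝ (defFun H) p v j = (v.2 j).im - 2 * (bil H v.1 (star p.1) j).re := by
  have hline : HasDerivAt (fun t : ℝ => p + t • v) v 0 := by
    simpa using ((hasDerivAt_id (0 : ℝ)).smul_const v).const_add p
  have h1 : HasDerivAt (fun t : ℝ => defFun H (p + t • v)) (fderiv ℝ (defFun H) p v) 0 :=
    HasFDerivAt.comp_hasDerivAt (l := defFun H) (0 : ℝ)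
      (by simpa using (differentiable_defFun p).hasFDerivAt) hline
  have h2 := hasDerivAt_pi.mp h1 j
  have hsym : (bil H p.1 (star v.1) j).re = (bil H v.1 (star p.1) j).re := by
    have := congrFun (star_bil hH v.1 (star p.1)) j
    rw [star_star] at this
    rw [← this]
    simp
  have e : ∀ t : ℝ, defFun H (p + t • v) j = defFun H p j +
      (t * ((v.2 j).im - 2 * (bil H v.1 (star p.1) j).re) +
        t ^ 2 * -(bil H v.1 (star v.1) j).re) := fun t => by
    have hs : ∀ x : Fin n → ℂ, t • x = (t : ℂ) • x := fun x => by ext; simp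
    simp only [defFun, form_eq_bil, Prod.fst_add, Prod.snd_add, Prod.smul_fst, Prod.smul_snd, hs,
      star_add, star_smul, map_add, map_smul, LinearMap.add_apply, LinearMap.smul_apply,
      Pi.add_apply, Pi.smul_apply, Complex.add_re, Complex.add_im, smul_eq_mul,
      Complex.star_def, Complex.conj_ofReal, Complex.re_ofReal_mul, Complex.smul_im, hsym]
    ring
  refine h2.unique ?_
  have h3 : HasDerivAt (fun t : ℝ => defFun H p j +
      (t * ((v.2 j).im - 2 * (bil H v.1 (star p.1) j).re) +
        t ^ 2 * -(bil H v.1 (star v.1) j).re))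
      ((v.2 j).im - 2 * (bil H v.1 (star p.1) j).re) 0 := by
    have := (((hasDerivAt_id (0 : ℝ)).mul_const
      ((v.2 j).im - 2 * (bil H v.1 (star p.1) j).re)).add
      (((hasDerivAt_id (0 : ℝ)).pow 2).mul_const (-(bil H v.1 (star v.1) j).re))).const_add
      (defFun H p j)
    exact this.congr_deriv (by simp)
  exact h3.congr_of_eventuallyEq (Eventually.of_forall e)

lemma isTangentNear_iff (hH : ∀ j, (H j).IsHermitian) (ξ : Amb n k) (F : Amb n k → Amb n k) :
    IsTangentNear H ξ F ↔ ∀ᶠ p in 𝓝 ξ, p ∈ quadric H →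
      ∀ j, ((F p).2 j).im = 2 * (bil H (F p).1 (star p.1) j).re := by
  simp only [IsTangentNear, funext_iff, fderiv_defFun hH, Pi.zero_apply, sub_eq_zero]

lemma dilation_mem_quadric {p : Amb n k} (hp : p ∈ quadric H) (t : ℝ) :
    (((t : ℂ) • p.1, (t : ℂ) ^ 2 • p.2) : Amb n k) ∈ quadric H := by
  rw [mem_quadric_iff] at hp ⊢
  intro j
  have := hp j
  simp only [star_smul, map_smul, LinearMap.smul_apply, Pi.smul_apply, smul_eq_mul,
    Complex.star_def, Complex.conj_ofReal, ← Complex.ofReal_pow, Complex.re_ofReal_mul,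
    Complex.im_ofReal_mul, this]
  ring

end Tangency

/-! ### Weighted homogeneous components of tangent fields -/

section Components

open MvPolynomial

variable {n k : ℕ} {H : Fin k → Matrix (Fin n) (Fin n) ℂ}

lemma tendsto_dilation (p : Amb n k) :
    Tendsto (fun t : ℝ => (((t : ℂ) • p.1, (t : ℂ) ^ 2 • p.2) : Amb n k)) (𝓝 0) (𝓝 0) := by
  have : Continuous (fun t : ℝ => (((t : ℂ) • p.1, (t : ℂ) ^ 2 • p.2) : Amb n k)) := by
    fun_prop
  refine this.tendsto' 0 0 ?_
  simp

lemma eq_zero_of_hasSum_pow_mul {b : ℕ → ℝ}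
    (h : ∀ᶠ t : ℝ in 𝓝 0, HasSum (fun N => t ^ N * b N) 0) : b = 0 := by
  have hps : HasFPowerSeriesAt (0 : ℝ → ℝ) (FormalMultilinearSeries.ofScalars ℝ b) 0 := by
    rw [hasFPowerSeriesAt_iff]
    simpa [FormalMultilinearSeries.coeff_ofScalars] using h
  have h0 := hps.eq_zero
  ext N
  rw [← FormalMultilinearSeries.coeff_ofScalars (𝕜 := ℝ) (p := b), h0]
  rfl

/-- The component of weight `N - 2` of the field with the expansions `∑ P N` and `∑ R N`. -/
def component (P : Fin n → ℕ → Poly n k) (R : Fin k → ℕ → Poly n k) : ℕ → Amb n k → Amb n k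
  | 0 => polyField 0 fun j => R j 0
  | N + 1 => polyField (fun a => P a N) fun j => R j (N + 1)

lemma component_snd (P : Fin n → ℕ → Poly n k) (R : Fin k → ℕ → Poly n k) (N : ℕ)
    (p : Amb n k) (j : Fin k) :
    (component P R N p).2 j = eval (Sum.elim p.1 p.2) (R j N) := by
  cases N <;> rfl

lemma hasSum_component {F : Amb n k → Amb n k} {P : Fin n → ℕ → Poly n k}
    {R : Fin k → ℕ → Poly n k} {p : Amb n k}
    (hP : ∀ a, HasSum (fun N => eval (Sum.elim p.1 p.2) (P a N)) ((F p).1 a))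
    (hR : ∀ j, HasSum (fun N => eval (Sum.elim p.1 p.2) (R j N)) ((F p).2 j)) :
    HasSum (fun N => component P R N p) (F p) := by
  refine HasSum.prodMk (f := fun N => (component P R N p).1) (g := fun N => (component P R N p).2)
    ?_ ?_
  · rw [Pi.hasSum]
    intro a
    rw [← hasSum_nat_add_iff' 1]
    simpa [component, polyField] using hP a
  · rw [Pi.hasSum]
    intro j
    simpa only [component_snd] using hR j

/-- Along the orbit (tz, t²w), t real, of a point of the quadric, the tangency defect is a power
series in t whose N-th coefficient is the defect of the N-th component. It vanishes for small t, so
every coefficient does. -/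
lemma isTangent_component (hH : ∀ j, (H j).IsHermitian) {F : Amb n k → Amb n k}
    (hT : IsTangentNear H 0 F) {P : Fin n → ℕ → Poly n k} {R : Fin k → ℕ → Poly n k}
    (hPw : ∀ a N, (P a N).IsWeightedHomogeneous (wt n k) (N : ℤ))
    (hRw : ∀ j N, (R j N).IsWeightedHomogeneous (wt n k) (N : ℤ))
    (hsum : ∀ᶠ p in 𝓝 0, HasSum (fun N => component P R N p) (F p)) (N : ℕ) :
    IsTangent H (component P R N) := by
  intro p hp j
  set b : ℕ → ℝ := fun N => ((component P R N p).2 j).im -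
    2 * (bil H (component P R N p).1 (star p.1) j).re with hb
  have hscale : ∀ (t : ℝ) N,
      ((component P R N (((t : ℂ) • p.1, (t : ℂ) ^ 2 • p.2) : Amb n k)).2 j).im -
        2 * (bil H (component P R N (((t : ℂ) • p.1, (t : ℂ) ^ 2 • p.2) : Amb n k)).1
          (star ((t : ℂ) • p.1)) j).re = t ^ N * b N := fun t N => by
    have h2 : (component P R N (((t : ℂ) • p.1, (t : ℂ) ^ 2 • p.2) : Amb n k)).2 j =
        (t : ℂ) ^ N * (component P R N p).2 j := by
      rw [component_snd, component_snd]
      exact eval_smul_of_isWeightedHomogeneous (hRw j N) t p.1 p.2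
    -- The first part has weight N − 1; the extra factor t, supplied below by star (t • z), avoids a
    -- negative exponent at N = 0.
    have h1 : (t : ℂ) • (component P R N (((t : ℂ) • p.1, (t : ℂ) ^ 2 • p.2) : Amb n k)).1 =
        (t : ℂ) ^ N • (component P R N p).1 := by
      cases N with
      | zero => ext a; simp [component, polyField]
      | succ N =>
        ext a
        have := eval_smul_of_isWeightedHomogeneous (hPw a N) t p.1 p.2
        simp only [component, polyField, Pi.smul_apply, smul_eq_mul, this]
        ring
    have h1' : bil H (component P R N (((t : ℂ) • p.1, (t : ℂ) ^ 2 • p.2) : Amb n k)).1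
        (star ((t : ℂ) • p.1)) j = (t : ℂ) ^ N * bil H (component P R N p).1 (star p.1) j := by
      have h3 := congrFun (congrArg (fun x => bil H x (star p.1)) h1) j
      simpa using h3
    rw [h2, h1', ← Complex.ofReal_pow, Complex.re_ofReal_mul, Complex.im_ofReal_mul, hb]
    ring
  have hb0 : b = 0 := by
    refine eq_zero_of_hasSum_pow_mul ?_
    have hT' := (isTangentNear_iff hH 0 F).mp hT
    filter_upwards [(tendsto_dilation p).eventually hsum, (tendsto_dilation p).eventually hT']
      with t h1 h2
    have h3 := h2 (dilation_mem_quadric hp t) j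
    set p' : Amb n k := ((t : ℂ) • p.1, (t : ℂ) ^ 2 • p.2) with hp'
    have hsnd : HasSum (fun N => (component P R N p').2 j) ((F p').2 j) :=
      Pi.hasSum.mp (h1.map (AddMonoidHom.snd _ _) continuous_snd) j
    have hfst : HasSum (fun N => (component P R N p').1) ((F p').1) :=
      h1.map (AddMonoidHom.fst _ _) continuous_fst
    have hbil : HasSum (fun N => bil H (component P R N p').1 (star p'.1) j)
        (bil H (F p').1 (star p'.1) j) := by
      let L : (Fin n → ℂ) →ₗ[ℂ] (Fin k → ℂ) := (bil H).flip (star p'.1)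
      exact Pi.hasSum.mp (hfst.map L (LinearMap.continuous_of_finiteDimensional L)) j
    have h4 := (Complex.hasSum_im hsnd).sub ((Complex.hasSum_re hbil).mul_left 2)
    rw [h3, sub_self] at h4
    have e : (fun N => t ^ N * b N) = fun N => ((component P R N p').2 j).im -
        2 * (bil H (component P R N p').1 (star p'.1) j).re := funext fun N => (hscale t N).symm
    rw [e]
    exact h4
  have := congrFun hb0 N
  simp only [hb, Pi.zero_apply] at this
  exact sub_eq_zero.mp this

lemma IsTangent.isTangentNear (hH : ∀ j, (H j).IsHermitian) {F : Amb n k → Amb n k}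
    (hT : IsTangent H F) (ξ : Amb n k) : IsTangentNear H ξ F :=
  (isTangentNear_iff hH ξ F).mpr (Eventually.of_forall fun p hp => hT p hp)

lemma isQuasiHomogeneous_polyField {P : Fin n → Poly n k} {R : Fin k → Poly n k} {M : ℕ}
    (hP : ∀ a, (P a).IsWeightedHomogeneous (wt n k) (M : ℤ))
    (hR : ∀ j, (R j).IsWeightedHomogeneous (wt n k) ((M + 1 : ℕ) : ℤ)) :
    IsQuasiHomogeneous (polyField P R) M := fun t z w =>
  ⟨funext fun a => eval_smul_of_isWeightedHomogeneous (hP a) t z w,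
    funext fun j => eval_smul_of_isWeightedHomogeneous (hR j) t z w⟩

/-- A germ of a tangent field at the origin is a finite sum of its weighted homogeneous
components. -/
theorem exists_components (hk : 0 < k) (hH : Nondegenerate H) {X : Germ (𝓝 (0 : Amb n k)) (Amb n k)}
    (hX : X ∈ autAt H 0) :
    ∃ (P : Fin n → ℕ → Poly n k) (R : Fin k → ℕ → Poly n k),
      (∀ a N, (P a N).IsWeightedHomogeneous (wt n k) (N : ℤ)) ∧
      (∀ j N, (R j N).IsWeightedHomogeneous (wt n k) (N : ℤ)) ∧
      (∀ N, IsTangent H (component P R N)) ∧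
      X = ((∑ N ∈ Finset.range (2 * k + 3), component P R N : Amb n k → Amb n k) :
        Germ (𝓝 (0 : Amb n k)) (Amb n k)) := by
  obtain ⟨F, hF, hT, rfl⟩ := hX
  have hF1 : ∀ a, AnalyticAt ℂ (fun p => (F p).1 a) 0 := fun a =>
    (((ContinuousLinearMap.proj (R := ℂ) (φ := fun _ : Fin n => ℂ) a).comp
      (ContinuousLinearMap.fst ℂ (Fin n → ℂ) (Fin k → ℂ))).analyticAt (F 0)).comp hF
  have hF2 : ∀ j, AnalyticAt ℂ (fun p => (F p).2 j) 0 := fun j =>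
    (((ContinuousLinearMap.proj (R := ℂ) (φ := fun _ : Fin k => ℂ) j).comp
      (ContinuousLinearMap.snd ℂ (Fin n → ℂ) (Fin k → ℂ))).analyticAt (F 0)).comp hF
  choose P hPw hPs using fun a => exists_weighted_expansion (hF1 a)
  choose R hRw hRs using fun j => exists_weighted_expansion (hF2 j)
  have hsum : ∀ᶠ p in 𝓝 0, HasSum (fun N => component P R N p) (F p) := by
    filter_upwards [eventually_all.mpr hPs, eventually_all.mpr hRs] with p h1 h2
    exact hasSum_component h1 h2
  have htan := isTangent_component hH.hermitian hT hPw hRw hsum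
  refine ⟨P, R, hPw, hRw, htan, Germ.coe_eq.mpr ?_⟩
  filter_upwards [hsum] with p hp
  rw [Finset.sum_apply]
  refine hp.unique (hasSum_sum_of_ne_finset_zero fun N hN => ?_)
  rw [Finset.mem_range, not_lt] at hN
  -- The components of index N have weights N − 1 and N, so N ≥ 2k+3 means M = N − 1 ≥ 2k+2.
  obtain ⟨M, rfl⟩ : ∃ M, N = M + 1 := ⟨N - 1, by omega⟩
  have : component P R (M + 1) = 0 :=
    eq_zero_of_weight hk hH (differentiable_polyField _ _) (htan _) (M := M) (by omega)
      (isQuasiHomogeneous_polyField (fun a => hPw a M) fun j => hRw j (M + 1))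
  rw [this]
  rfl

end Components

section Grading

open MvPolynomial

variable {n k : ℕ} {H : Fin k → Matrix (Fin n) (Fin n) ℂ}

/-! ### Degrees of the components -/

lemma totalDegree_fst_le (hH : Nondegenerate H) {P : Fin n → Poly n k} {R : Fin k → Poly n k}
    (hT : IsTangent H (polyField P R)) {M B : ℕ} {a : Fin n}
    (hP : (P a).IsWeightedHomogeneous (wt n k) (M : ℤ)) (hB : M + 1 ≤ 2 * B) :
    (P a).totalDegree ≤ B := by
  refine totalDegree_le_of_isPolyLE (q := 2) hP (fun z w => ?_) (by omega)
  have h := fun s => congrFun (fst_smul_eq hH (differentiable_polyField P R) hT z w s) a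
  simp only [Pi.add_apply, Pi.smul_apply, smul_eq_mul] at h
  have e : (fun s : ℂ => eval (Sum.elim (s • z) w) (P a)) = _ := funext h
  have hc : ∀ c : ℂ, IsPolyLE 0 (fun _ => c) := fun c => ⟨.C c, by simp, by simp⟩
  rw [e]
  exact (((isPolyLE_quadratic _ _ _).mul (hc _)).add ((isPolyLE_quadratic _ _ _).mul (hc _))).add
    ((isPolyLE_quadratic _ _ _).mul (hc _))

lemma totalDegree_snd_le (hH : Nondegenerate H) {P : Fin n → Poly n k} {R : Fin k → Poly n k}
    (hT : IsTangent H (polyField P R)) {M B : ℕ} {j : Fin k}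
    (hR : (R j).IsWeightedHomogeneous (wt n k) (M : ℤ)) (hB : M ≤ 2 * B) :
    (R j).totalDegree ≤ B := by
  refine totalDegree_le_of_isPolyLE (q := 1) hR (fun z w => ?_) (by omega)
  have e : (fun s : ℂ => eval (Sum.elim (s • z) w) (R j)) = fun s => (polyField P R (0, w)).2 j +
      (2 * Complex.I * bil H z (conjField (polyField P R) (0, w)).1 j) * s := funext fun s => by
    have h := congrFun (snd_eq hH.hermitian (differentiable_polyField P R) hT (s • z) w) j
    simp only [Pi.add_apply, Pi.smul_apply, smul_eq_mul, map_smul, LinearMap.smul_apply] at h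
    refine h.trans ?_
    ring
  rw [e]
  exact isPolyLE_affine _ _

theorem exists_polyField_of_mem_autAt_zero (hk : 0 < k) (hH : Nondegenerate H)
    {X : Germ (𝓝 (0 : Amb n k)) (Amb n k)} (hX : X ∈ autAt H 0) :
    ∃ (P : Fin n → Poly n k) (R : Fin k → Poly n k),
      (∀ a, (P a).totalDegree ≤ k + 1) ∧ (∀ j, (R j).totalDegree ≤ k + 1) ∧
      X = (polyField P R : Germ (𝓝 (0 : Amb n k)) (Amb n k)) := by
  obtain ⟨P, R, hP, hR, hT, rfl⟩ := exists_components hk hH hX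
  refine ⟨fun a => ∑ N ∈ Finset.range (2 * k + 2), P a N,
    fun j => ∑ N ∈ Finset.range (2 * k + 3), R j N, fun a => ?_, fun j => ?_, ?_⟩
  · refine totalDegree_finsetSum_le fun N hN => ?_
    rw [Finset.mem_range] at hN
    exact totalDegree_fst_le hH (hT (N + 1)) (hP a N) (by omega)
  · refine totalDegree_finsetSum_le fun N hN => ?_
    rw [Finset.mem_range] at hN
    cases N with
    | zero => exact totalDegree_snd_le hH (hT 0) (hR j 0) (by omega)
    | succ N => exact totalDegree_snd_le hH (hT (N + 1)) (hR j (N + 1)) (by omega)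
  · congr 1
    ext p i
    -- The component of index 0 has no first part, which accounts for the shift between the two
    -- ranges.
    · rw [Finset.sum_apply, Prod.fst_sum, Finset.sum_apply, Finset.sum_range_succ']
      simp [component, polyField]
    · rw [Finset.sum_apply, Prod.snd_sum, Finset.sum_apply]
      simp only [component_snd, polyField, map_sum]

/-! ### The graded components -/

lemma coe_mem_autAt (hH : Nondegenerate H) {P : Fin n → Poly n k} {R : Fin k → Poly n k}
    (hT : IsTangent H (polyField P R)) (ξ : Amb n k) :
    (polyField P R : Germ (𝓝 ξ) (Amb n k)) ∈ autAt H ξ :=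
  ⟨_, analyticAt_polyField P R ξ, hT.isTangentNear hH.hermitian ξ, rfl⟩

lemma component_mem_gr (hH : Nondegenerate H) {P : Fin n → ℕ → Poly n k}
    {R : Fin k → ℕ → Poly n k}
    (hP : ∀ a N, (P a N).IsWeightedHomogeneous (wt n k) (N : ℤ))
    (hR : ∀ j N, (R j N).IsWeightedHomogeneous (wt n k) (N : ℤ)) (N : ℕ)
    (hT : IsTangent H (component P R N)) :
    (component P R N : Germ (𝓝 (0 : Amb n k)) (Amb n k)) ∈ gr H (N - 2) := by
  cases N with
  | zero =>
    refine ⟨coe_mem_autAt hH hT 0, 0, fun j => R j 0, fun a => isWeightedHomogeneous_zero _ _ _,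
      fun j => ?_, rfl⟩
    simpa using hR j 0
  | succ N =>
    refine ⟨coe_mem_autAt hH hT 0, fun a => P a N, fun j => R j (N + 1), fun a => ?_,
      fun j => ?_, rfl⟩
    · convert hP a N using 1
      push_cast
      ring
    · convert hR j (N + 1) using 1
      ring

lemma germ_coe_sum {α ι : Type*} {β : Type*} [AddCommMonoid β] (l : Filter α) (s : Finset ι)
    (f : ι → α → β) :
    ((∑ i ∈ s, f i : α → β) : Germ l β) = ∑ i ∈ s, (f i : Germ l β) :=
  map_sum (Germ.coeAddHom l) f s

theorem autAt_zero_eq_iSup (hk : 0 < k) (hH : Nondegenerate H) :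
    autAt H 0 = ⨆ m ∈ Set.Icc (-2 : ℤ) (2 * (k : ℤ)), gr H m := by
  refine le_antisymm (fun X hX => ?_) (iSup₂_le fun m _ X hX => hX.1)
  obtain ⟨P, R, hP, hR, hT, rfl⟩ := exists_components hk hH hX
  rw [germ_coe_sum]
  refine Submodule.sum_mem _ fun N hN => ?_
  rw [Finset.mem_range] at hN
  refine Submodule.mem_iSup_of_mem ((N : ℤ) - 2) (Submodule.mem_iSup_of_mem ?_
    (component_mem_gr hH hP hR N (hT N)))
  constructor <;> omega

/-- A dilation with small t ≠ 0 moves any point of the quadric near 0, and the tangency condition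
just scales by t^(M+1). -/
lemma isTangent_of_isTangentNear (hH : Nondegenerate H) {F : Amb n k → Amb n k} {M : ℕ}
    (hq : IsQuasiHomogeneous F M) (hT : IsTangentNear H 0 F) : IsTangent H F := by
  intro p hp j
  have hT' := (isTangentNear_iff hH.hermitian 0 F).mp hT
  have hev := ((tendsto_dilation p).eventually hT').filter_mono
    (nhdsWithin_le_nhds (s := {0}ᶜ))
  obtain ⟨t, ht, ht0⟩ := (hev.and eventually_mem_nhdsWithin).exists
  have h := ht (dilation_mem_quadric hp t) j
  rw [(hq t p.1 p.2).1, (hq t p.1 p.2).2] at h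
  simp only [star_smul, map_smul, LinearMap.smul_apply, Pi.smul_apply, smul_eq_mul,
    Complex.star_def, Complex.conj_ofReal, ← Complex.ofReal_pow, Complex.re_ofReal_mul,
    Complex.im_ofReal_mul] at h
  refine mul_left_cancel₀ (pow_ne_zero (M + 1) (show t ≠ 0 from ht0)) ?_
  refine h.trans ?_
  ring

theorem le_of_gr_ne_bot (hk : 0 < k) (hH : Nondegenerate H) {m : ℤ} (hm : gr H m ≠ ⊥) :
    m ≤ 2 * (k : ℤ) := by
  by_contra! hlt
  refine hm ((Submodule.eq_bot_iff _).mpr ?_)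
  rintro X ⟨⟨F, -, hFT, hXF⟩, P, R, hP, hR, rfl⟩
  obtain ⟨M, hM⟩ : ∃ M : ℕ, (M : ℤ) = m + 1 := ⟨(m + 1).toNat, Int.toNat_of_nonneg (by omega)⟩
  have hq : IsQuasiHomogeneous (polyField P R) M := isQuasiHomogeneous_polyField
    (fun a => hM ▸ hP a) (fun j => by
      have : ((M + 1 : ℕ) : ℤ) = m + 2 := by push_cast; omega
      exact this ▸ hR j)
  have hT : IsTangentNear H 0 (polyField P R) := by
    filter_upwards [hFT, Germ.coe_eq.mp hXF] with p h1 h2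
    rwa [h2]
  rw [eq_zero_of_weight hk hH (differentiable_polyField P R)
    (isTangent_of_isTangentNear hH hq hT) (by omega) hq]
  rfl

/-- A polynomial with zero germ is zero, so a vanishing sum can be separated into weighted
homogeneous components coefficientwise. -/
theorem iSupIndep_gr : iSupIndep (gr H) := by
  classical
  rw [iSupIndep_iff_finsetSum_eq_zero_imp_eq_zero]
  intro s x hx hsum m hm
  choose hmem P R hP hR hX using fun m : s => hx m.1 m.2
  have hpoly : ∀ m : s, x m.1 = (polyField (P m) (R m) : Germ (𝓝 (0 : Amb n k)) (Amb n k)) := hX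
  have e : ((∑ m : s, polyField (P m) (R m) : Amb n k → Amb n k) :
      Germ (𝓝 (0 : Amb n k)) (Amb n k)) = ((0 : Amb n k → Amb n k) : Germ _ _) := by
    rw [germ_coe_sum]
    refine Eq.trans ?_ hsum
    rw [← Finset.sum_coe_sort s x]
    exact Finset.sum_congr rfl fun m _ => (hpoly m).symm
  have hev := Germ.coe_eq.mp e
  have hPsum : ∀ a, ∑ m : s, P m a = 0 := fun a => eq_zero_of_eventually_eval_eq_zero <| by
    filter_upwards [hev] with p hp
    have := congrFun (congrArg Prod.fst hp) a
    rw [Finset.sum_apply, Prod.fst_sum, Finset.sum_apply] at this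
    rw [map_sum]
    exact this
  have hRsum : ∀ j, ∑ m : s, R m j = 0 := fun j => eq_zero_of_eventually_eval_eq_zero <| by
    filter_upwards [hev] with p hp
    have := congrFun (congrArg Prod.snd hp) j
    rw [Finset.sum_apply, Prod.snd_sum, Finset.sum_apply] at this
    rw [map_sum]
    exact this
  have hzero : ∀ (Q : s → Poly n k) (c : ℤ),
      (∀ m, (Q m).IsWeightedHomogeneous (wt n k) (m.1 + c)) → ∑ m, Q m = 0 → ∀ m, Q m = 0 :=
    fun Q c hQ hQs m => by
      have h := congrArg (weightedHomogeneousComponent (wt n k) (m.1 + c)) hQs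
      rw [map_sum, map_zero, Finset.sum_eq_single m] at h
      · rwa [(hQ m).weightedHomogeneousComponent_same] at h
      · intro m' _ hne
        exact (hQ m').weightedHomogeneousComponent_ne _ fun h => hne (Subtype.ext (by omega))
      · simp
  have hP0 : P ⟨m, hm⟩ = 0 :=
    funext fun a => hzero (fun m => P m a) 1 (fun m => hP m a) (hPsum a) ⟨m, hm⟩
  have hR0 : R ⟨m, hm⟩ = 0 :=
    funext fun j => hzero (fun m => R m j) 2 (fun m => hR m j) (hRsum j) ⟨m, hm⟩
  rw [hpoly ⟨m, hm⟩, hP0, hR0]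
  have h : polyField (0 : Fin n → Poly n k) (0 : Fin k → Poly n k) = 0 := by
    ext p <;> simp [polyField]
  rw [h]
  rfl

/-! ### Translation to an arbitrary point of the quadric -/

/-- The affine automorphism of the quadric that takes `0` to `ξ`. -/
def translation (H : Fin k → Matrix (Fin n) (Fin n) ℂ) (ξ p : Amb n k) : Amb n k :=
  (p.1 + ξ.1, p.2 + ξ.2 + (2 * Complex.I) • bil H p.1 (star ξ.1))

/-- The inverse of `translation`. -/
def translationInv (H : Fin k → Matrix (Fin n) (Fin n) ℂ) (ξ q : Amb n k) : Amb n k :=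
  (q.1 - ξ.1, q.2 - ξ.2 - (2 * Complex.I) • bil H (q.1 - ξ.1) (star ξ.1))

lemma translation_translationInv (ξ q : Amb n k) :
    translation H ξ (translationInv H ξ q) = q := by
  ext i
  · simp [translation, translationInv]
  · simp [translation, translationInv]
    ring

lemma translation_mem_quadric (hH : ∀ j, (H j).IsHermitian) {ξ p : Amb n k}
    (hξ : ξ ∈ quadric H) (hp : p ∈ quadric H) : translation H ξ p ∈ quadric H := by
  rw [mem_quadric_iff] at *
  intro j
  have hsym : (bil H ξ.1 (star p.1) j).re = (bil H p.1 (star ξ.1) j).re := by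
    have := congrFun (star_bil hH p.1 (star ξ.1)) j
    rw [star_star] at this
    rw [← this]
    simp
  simp only [translation, star_add, map_add, LinearMap.add_apply, Pi.add_apply, Pi.smul_apply,
    Complex.add_im, Complex.add_re, smul_eq_mul, hp j, hξ j, hsym]
  simp
  ring

lemma analyticAt_translation (ξ p : Amb n k) : AnalyticAt ℂ (translation H ξ) p := by
  let L : (Fin n → ℂ) →L[ℂ] (Fin k → ℂ) :=
    LinearMap.toContinuousLinearMap ((2 * Complex.I) • (bil H).flip (star ξ.1))
  have e : translation H ξ = fun p => p + ξ + (ContinuousLinearMap.inr ℂ (Fin n → ℂ) (Fin k → ℂ) ∘L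
      L ∘L ContinuousLinearMap.fst ℂ (Fin n → ℂ) (Fin k → ℂ)) p := by
    ext p i <;> simp [translation, L]
  rw [e]
  exact (analyticAt_id.add analyticAt_const).add (ContinuousLinearMap.analyticAt _ p)

/-- The coordinates of `translationInv` as polynomials. -/
def translationInvPoly (H : Fin k → Matrix (Fin n) (Fin n) ℂ) (ξ : Amb n k) :
    Fin n ⊕ Fin k → Poly n k :=
  Sum.elim (fun a => X (.inl a) - C (ξ.1 a)) fun j => X (.inr j) - C (ξ.2 j) -
    ∑ a, ∑ b, C (2 * Complex.I * H j a b * star (ξ.1 b)) * (X (.inl a) - C (ξ.1 a))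

lemma totalDegree_translationInvPoly_le (ξ : Amb n k) (i : Fin n ⊕ Fin k) :
    (translationInvPoly H ξ i).totalDegree ≤ 1 := by
  have h : ∀ (i : Fin n ⊕ Fin k) (c : ℂ), (X i - C c : Poly n k).totalDegree ≤ 1 := fun i c =>
    (totalDegree_sub_C_le _ _).trans (totalDegree_X i).le
  rcases i with a | j
  · exact h _ _
  · refine (totalDegree_sub _ _).trans (max_le (h _ _) ?_)
    refine totalDegree_finsetSum_le fun a _ => totalDegree_finsetSum_le fun b _ => ?_
    refine (totalDegree_mul _ _).trans ?_
    rw [totalDegree_C, zero_add]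
    exact h _ _

lemma eval_aeval_translationInvPoly (ξ q : Amb n k) (Q : Poly n k) :
    eval (Sum.elim q.1 q.2) (aeval (translationInvPoly H ξ) Q) =
      eval (Sum.elim (translationInv H ξ q).1 (translationInv H ξ q).2) Q := by
  rw [map_aeval]
  have e : (fun i => eval (Sum.elim q.1 q.2) (translationInvPoly H ξ i)) =
      Sum.elim (translationInv H ξ q).1 (translationInv H ξ q).2 := by
    ext i
    rcases i with a | j
    · simp [translationInvPoly, translationInv]
    · have hb : ((2 * Complex.I) • bil H (q.1 - ξ.1) (star ξ.1)) j =
          ∑ a, ∑ b, 2 * Complex.I * H j a b * star (ξ.1 b) * (q.1 a - ξ.1 a) := by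
        rw [Pi.smul_apply, smul_eq_mul, bil_apply, Finset.mul_sum]
        refine Finset.sum_congr rfl fun a _ => ?_
        rw [Finset.mul_sum]
        refine Finset.sum_congr rfl fun b _ => ?_
        rw [Pi.sub_apply, Pi.star_apply]
        ring
      change _ = q.2 j - ξ.2 j - ((2 * Complex.I) • bil H (q.1 - ξ.1) (star ξ.1)) j
      rw [hb]
      simp [translationInvPoly]
  rw [e]
  exact eval₂Hom_congr (RingHom.ext fun c => by simp) rfl rfl

lemma continuous_translationInv (ξ : Amb n k) : Continuous (translationInv H ξ) := by
  have h : Differentiable ℂ (fun p : Amb n k => bil H (p.1 - ξ.1) (star ξ.1)) :=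
    differentiable_bil (differentiable_fst.sub_const _) (differentiable_const _)
  have h' := h.continuous
  unfold translationInv
  fun_prop

/-- Pull the field back to the origin by an affine automorphism of the quadric. Affine changes of
variables preserve the degree bound. -/
theorem exists_polyField_of_mem_autAt (hk : 0 < k) (hH : Nondegenerate H) {ξ : Amb n k}
    (hξ : ξ ∈ quadric H) {X : Germ (𝓝 ξ) (Amb n k)} (hX : X ∈ autAt H ξ) :
    ∃ (P : Fin n → Poly n k) (R : Fin k → Poly n k),
      (∀ a, (P a).totalDegree ≤ k + 1) ∧ (∀ j, (R j).totalDegree ≤ k + 1) ∧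
      X = (polyField P R : Germ (𝓝 ξ) (Amb n k)) := by
  obtain ⟨F, hF, hT, rfl⟩ := hX
  have hT0 : translation H ξ 0 = ξ := by ext i <;> simp [translation]
  let L : (Fin n → ℂ) →L[ℂ] (Fin k → ℂ) :=
    LinearMap.toContinuousLinearMap ((2 * Complex.I) • (bil H).flip (star ξ.1))
  have hL : ∀ x j, L x j = 2 * Complex.I * bil H x (star ξ.1) j := fun x j => by simp [L]
  -- S is the linear part of `translationInv`, so p ↦ S(F(translation p)) is the pulled-back field.
  let S : Amb n k →L[ℂ] Amb n k := (ContinuousLinearMap.fst ℂ _ _).prod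
    (ContinuousLinearMap.snd ℂ _ _ - L ∘L ContinuousLinearMap.fst ℂ _ _)
  have hFt : AnalyticAt ℂ (fun p => F (translation H ξ p)) 0 :=
    AnalyticAt.comp (g := F) (by rwa [hT0]) (analyticAt_translation ξ 0)
  have hSF : AnalyticAt ℂ (fun p => S (F (translation H ξ p))) 0 :=
    (S.analyticAt _).comp hFt
  have htend : Tendsto (translation H ξ) (𝓝 0) (𝓝 ξ) := by
    have := (analyticAt_translation (H := H) ξ 0).continuousAt
    rwa [ContinuousAt, hT0] at this
  have hST : IsTangentNear H 0 (fun p => S (F (translation H ξ p))) := by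
    rw [isTangentNear_iff hH.hermitian] at hT ⊢
    filter_upwards [htend.eventually hT] with p hp hpQ j
    have h := hp (translation_mem_quadric hH.hermitian hξ hpQ) j
    have e1 : (S (F (translation H ξ p))).1 = (F (translation H ξ p)).1 := rfl
    have e2 : (S (F (translation H ξ p))).2 j = (F (translation H ξ p)).2 j -
        L (F (translation H ξ p)).1 j := rfl
    rw [e1, e2, hL, Complex.sub_im, h]
    simp only [translation, star_add, map_add, Pi.add_apply, Complex.add_re]
    simp
    ring
  obtain ⟨P, R, hP, hR, hPR⟩ := exists_polyField_of_mem_autAt_zero hk hH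
    (X := ((fun p => S (F (translation H ξ p)) : Amb n k → Amb n k) : Germ _ _))
    ⟨_, hSF, hST, rfl⟩
  refine ⟨fun a => aeval (translationInvPoly H ξ) (P a),
    fun j => aeval (translationInvPoly H ξ) (R j) + ∑ a, ∑ b,
      C (2 * Complex.I * H j a b * star (ξ.1 b)) * aeval (translationInvPoly H ξ) (P a),
    fun a => (totalDegree_aeval_le _ (totalDegree_translationInvPoly_le ξ) _).trans (hP a),
    fun j => (totalDegree_add _ _).trans (max_le
      ((totalDegree_aeval_le _ (totalDegree_translationInvPoly_le ξ) _).trans (hR j))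
      (totalDegree_finsetSum_le fun a _ => totalDegree_finsetSum_le fun b _ => ?_)), ?_⟩
  · refine (totalDegree_mul _ _).trans ?_
    rw [totalDegree_C, zero_add]
    exact (totalDegree_aeval_le _ (totalDegree_translationInvPoly_le ξ) _).trans (hP a)
  · have htend' : Tendsto (translationInv H ξ) (𝓝 ξ) (𝓝 0) := by
      have := (continuous_translationInv (H := H) ξ).tendsto ξ
      have e0 : translationInv H ξ ξ = 0 := by ext i <;> simp [translationInv]
      rwa [e0] at this
    rw [Germ.coe_eq] at hPR ⊢
    filter_upwards [htend'.eventually hPR] with q hq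
    rw [translation_translationInv] at hq
    have h1 : ∀ a, (F q).1 a = eval (Sum.elim q.1 q.2) (aeval (translationInvPoly H ξ) (P a)) :=
      fun a => by
        rw [eval_aeval_translationInvPoly]
        exact congrFun (congrArg Prod.fst hq) a
    have h2 : ∀ j, (F q).2 j - L (F q).1 j =
        eval (Sum.elim q.1 q.2) (aeval (translationInvPoly H ξ) (R j)) := fun j => by
      rw [eval_aeval_translationInvPoly]
      exact congrFun (congrArg Prod.snd hq) j
    refine Prod.ext (funext h1) (funext fun j => ?_)
    rw [← sub_add_cancel ((F q).2 j) (L (F q).1 j), h2, hL, bil_apply, Finset.mul_sum]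
    simp only [polyField, map_add, map_sum, map_mul, eval_C]
    congr 1
    refine Finset.sum_congr rfl fun a _ => ?_
    rw [Finset.mul_sum]
    refine Finset.sum_congr rfl fun b _ => ?_
    rw [h1, Pi.star_apply]
    ring

end Grading

end CRQuadric

/-! ### The bounds on weights and degrees -/

theorem mainTheorem1 {n k : ℕ} (hn : 0 < n) (hk : 0 < k)
    (H : Fin k → Matrix (Fin n) (Fin n) ℂ) (hH : CRQuadric.Nondegenerate H) :
    -- the fields of odd weight have weight at most `2k - 1`
    (∀ m : ℤ, Odd m → CRQuadric.gr H m ≠ ⊥ → m ≤ 2 * (k : ℤ) - 1) ∧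
    -- every field has weight at most `2k`, and `aut Q = g_{-2} ⊕ … ⊕ g_{2k}`
    (∀ m : ℤ, CRQuadric.gr H m ≠ ⊥ → m ≤ 2 * (k : ℤ)) ∧
    iSupIndep (CRQuadric.gr H) ∧
    (CRQuadric.autAt H 0 = ⨆ m ∈ Set.Icc (-2 : ℤ) (2 * (k : ℤ)), CRQuadric.gr H m) ∧
    -- at every point of the quadric the coefficients are polynomials of degree at most `k + 1`
    (∀ ξ ∈ CRQuadric.quadric H, ∀ X ∈ CRQuadric.autAt H ξ,
      ∃ (P : Fin n → CRQuadric.Poly n k) (R : Fin k → CRQuadric.Poly n k),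
        (∀ a, (P a).totalDegree ≤ k + 1) ∧ (∀ j, (R j).totalDegree ≤ k + 1) ∧
        X = (CRQuadric.polyField P R : Filter.Germ (𝓝 ξ) (CRQuadric.Amb n k))) := by
  refine ⟨fun m hm hne => ?_, fun m hne => CRQuadric.le_of_gr_ne_bot hk hH hne,
    CRQuadric.iSupIndep_gr, CRQuadric.autAt_zero_eq_iSup hk hH,
    fun ξ hξ X hX => CRQuadric.exists_polyField_of_mem_autAt hk hH hξ hX⟩
  -- The odd case is the general bound with parity: an odd m ≤ 2k is at most 2k − 1.
  have := CRQuadric.le_of_gr_ne_bot hk hH hne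
  obtain ⟨r, rfl⟩ := hm
  omega

end
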